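/- **Omitting Types Theorem.** *Setting.* Let $\mathcal L$ be a countable continuous signature (function and predicate symbols, a distinguished binary predicate symbol $d$, and for each symbol and each argument place a uniform continuity modulus $\delta\colon(0,\infty)\to(0,\infty]$ with $\delta(\varepsilon)=\sup_{0<\varepsilon'<\varepsilon}\delta(\varepsilon')$). An $\mathcal L$-structure is a nonempty set with a complete metric $d^M\le 1$, functions $f^M\colon M^n\to M$ and predicates $P^M\colon M^n\to[0,1]$ that respect the given moduli in each argument (i.e. distance $<\delta(\varepsilon)$ in the argument implies distance $\le\varepsilon$ in the value). Formulas of $\mathcal L_{\omega_1,\omega}$ are built from atomic formulas by $\lnot\varphi=1-\varphi$, $\tfrac12\varphi$, $\varphi\dotplus\psi=\min(\varphi+\psi,1)$, $\inf_x$, and $\bigwedge\Phi=\inf_{\varphi\in\Phi}\varphi$ (infima in $[0,1]$) for countable sets $\Phi$ of formulas in a common finite tuple of free variables such that the syntactically computed moduli satisfy $\inf_{\varphi\in\Phi}\delta_{\varphi,x}(\varepsilon)>0$ for all $\varepsilon>0$ and every variable $x$ of the tuple; $\bigvee\Phi:=\lnot\bigwedge_{\varphi\in\Phi}\lnot\varphi$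 and $\sup_x\varphi:=\lnot\inf_x\lnot\varphi$. Let $\mathcal L_A$ be a countable fragment of $\mathcal L_{\omega_1,\omega}$, that is, a countable set of formulas containing all atomic formulas and closed under subformulas and under substitution of terms for free variables. Let $\Sigma\subseteq\mathcal L_A$ contain all atomic formulas and be closed under subformulas. Let $C=\{c_i\mid i<\omega\}$ be a set of new constant symbols, and let $\Sigma(C)$ be the set of formulas obtained from members of $\Sigma$ by replacing finitely many free variables by constants from $C$. An $\mathcal L(C)$-structure $M$ is *canonical* if $\{c_i^M\mid i<\omega\}$ is dense in $M$. Let $\mathcal M$ be a nonempty class of $\mathcal L$-structures. A set $\Gamma$ of inequalities $\varphi<r$ ($\varphi$ an $\mathcal L(C)$-sentence, $r\in\mathbb R$) is *satisfiable in $\mathcal M$* if there are $M\in\mathcal M$, a finite $C_0\subseteq C$ and $a_c\in M$ $(c\in C_0)$ such that every $\varphi$ occurring in $\Gamma$ is an $\mathcal L(C_0)$-sentence and $\varphi^{(M,a_c)_{c\in C_0}}<r$ for every inequality $\varphi<r$ in $\Gamma$. A *finite $\Sigma$-piece of $\mathcal M$* is a finite set of inequalities $\varphi<r$, with $\varphi$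 a sentence in $\Sigma(C)$ and $r\in\mathbb R$, that is satisfiable in $\mathcal M$. *Statement.* For each $n<\omega$ let $\varphi_n\in\mathcal L_A$ be a $\sup\bigwedge\inf$-formula over $\Sigma$, that is, $\varphi_n=\sup_{x_1}\dots\sup_{x_{m(n)}}\psi_n(\bar x_n)$ with $$\psi_n(\bar x_n)=\bigwedge_{k<\omega}\inf_{y_1}\dots\inf_{y_{i(n,k)}}\bigl(\sigma_{n,k,1}(\bar x_n,\bar y_{n,k})\lor\dots\lor\sigma_{n,k,j(n,k)}(\bar x_n,\bar y_{n,k})\bigr),$$ where all $\sigma_{n,k,\nu}$ belong to $\Sigma$, the variables $\bar x_n=x_1,\dots,x_{m(n)}$, $\bar y_{n,k}=y_1,\dots,y_{i(n,k)}$ are distinct, and the free variables of $\sigma_{n,k,\nu}$ are among $\bar x_n,\bar y_{n,k}$. Let $(r_n\mid n<\omega)$ be real numbers. Suppose that for every finite $\Sigma$-piece $p$ of $\mathcal M$, every $n<\omega$ and every $\bar c\in C^{m(n)}$ the set $p\cup\{\psi_n(\bar c)<r_n\}$ is satisfiable in $\mathcal M$. Then there is a canonical $\mathcal L(C)$-structure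 $M$ such that $\varphi_n^M\le r_n$ for every $n<\omega$. -/

import Mathlib

open FirstOrder
open scoped ENNReal

universe u v w

namespace ContLogic


/-- A continuous signature: function and predicate symbols of each finite arity, a distinguished
binary predicate symbol `d`, and for every symbol and every argument place a uniform continuity
modulus `δ : (0,∞) → (0,∞]` (only its values at positive reals matter) with
`δ ε = sup {δ ε' | 0 < ε' < ε}`. -/
structure Signature extends FirstOrder.Language.{u, v} where
  d : Relations 2
  modFun : ∀ {n : ℕ}, Functions n → Fin n → ℝ → ℝ≥0∞
  modRel : ∀ {n : ℕ}, Relations n → Fin n → ℝ → ℝ≥0∞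
  modFun_pos : ∀ {n : ℕ} (f : Functions n) (i : Fin n) (ε : ℝ), 0 < ε → 0 < modFun f i ε
  modRel_pos : ∀ {n : ℕ} (P : Relations n) (i : Fin n) (ε : ℝ), 0 < ε → 0 < modRel P i ε
  modFun_eq : ∀ {n : ℕ} (f : Functions n) (i : Fin n) (ε : ℝ), 0 < ε →
    modFun f i ε = ⨆ ε' ∈ Set.Ioo (0 : ℝ) ε, modFun f i ε'
  modRel_eq : ∀ {n : ℕ} (P : Relations n) (i : Fin n) (ε : ℝ), 0 < ε →
    modRel P i ε = ⨆ ε' ∈ Set.Ioo (0 : ℝ) ε, modRel P i ε'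

/-- The signature has only countably many symbols. -/
def Signature.IsCountable (L : Signature.{u, v}) : Prop :=
  Countable (Σ n, L.Functions n) ∧ Countable (Σ n, L.Relations n)

/-- The signature `L(K)`: `L` together with new constant symbols indexed by `K`. -/
def Signature.addConst (L : Signature.{u, v}) (K : Type) : Signature.{u, v} where
  toLanguage := L.toLanguage.withConstants K
  d := Sum.inl L.d
  modFun := fun {n} f i => match n, f, i with
    | _, Sum.inl f, i => L.modFun f i
    | 0, Sum.inr _, i => i.elim0
  modRel := fun {n} P i => match n, P, i with
    | _, Sum.inl P, i => L.modRel P i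
  modFun_pos := fun {n} f i ε h => match n, f, i with
    | _, Sum.inl f, i => L.modFun_pos f i ε h
    | 0, Sum.inr _, i => i.elim0
  modRel_pos := fun {n} P i ε h => match n, P, i with
    | _, Sum.inl P, i => L.modRel_pos P i ε h
  modFun_eq := fun {n} f i ε h => match n, f, i with
    | _, Sum.inl f, i => L.modFun_eq f i ε h
    | 0, Sum.inr _, i => i.elim0
  modRel_eq := fun {n} P i ε h => match n, P, i with
    | _, Sum.inl P, i => L.modRel_eq P i ε h

/-- A continuous `L`-structure: a nonempty set with a complete metric bounded by `1`, which
interprets `d`, and with interpretations of the symbols that respect, in each argument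
separately, the prescribed uniform continuity moduli. -/
structure MetricStructure (L : Signature.{u, v}) where
  carrier : Type w
  [nonempty : Nonempty carrier]
  [metric : MetricSpace carrier]
  [complete : CompleteSpace carrier]
  funMap : ∀ {n : ℕ}, L.Functions n → (Fin n → carrier) → carrier
  relMap : ∀ {n : ℕ}, L.Relations n → (Fin n → carrier) → unitInterval
  relMap_d : ∀ a : Fin 2 → carrier, (relMap L.d a : ℝ) = dist (a 0) (a 1)
  funMap_mod : ∀ {n : ℕ} (f : L.Functions n) (i : Fin n) (ε : ℝ), 0 < ε →
    ∀ (a : Fin n → carrier) (b : carrier),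
      ENNReal.ofReal (dist (a i) b) < L.modFun f i ε →
        dist (funMap f a) (funMap f (Function.update a i b)) ≤ ε
  relMap_mod : ∀ {n : ℕ} (P : L.Relations n) (i : Fin n) (ε : ℝ), 0 < ε →
    ∀ (a : Fin n → carrier) (b : carrier),
      ENNReal.ofReal (dist (a i) b) < L.modRel P i ε →
        dist (relMap P a) (relMap P (Function.update a i b)) ≤ ε

attribute [instance] MetricStructure.nonempty MetricStructure.metric MetricStructure.complete

/-- The `L(K)`-structure `(M, a_c)_{c ∈ K}`. -/
def MetricStructure.expand {L : Signature.{u, v}} (M : MetricStructure.{u, v, w} L) {K : Type}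
    (a : K → M.carrier) : MetricStructure.{u, v, w} (L.addConst K) where
  carrier := M.carrier
  funMap := fun {n} f x => match n, f, x with
    | _, Sum.inl f, x => M.funMap f x
    | 0, Sum.inr c, _ => a c
  relMap := fun {n} P x => match n, P, x with
    | _, Sum.inl P, x => M.relMap P x
  relMap_d := M.relMap_d
  funMap_mod := fun {n} f i ε h x b => match n, f, i, x with
    | _, Sum.inl f, i, x => M.funMap_mod f i ε h x b
    | 0, Sum.inr _, i, _ => i.elim0
  relMap_mod := fun {n} P i ε h x b => match n, P, i, x with
    | _, Sum.inl P, i, x => M.relMap_mod P i ε h x b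

/-! ### Syntax -/

/-- The raw formulas with variables `x₀, x₁, …` (indexed by `ℕ`). A countable set of formulas
under `⋀` is given as a family indexed by a set `I` of natural numbers, which may be empty,
finite or infinite. The condition on continuity moduli is `IsFormula` below. -/
inductive PreFormula (L : FirstOrder.Language.{u, v}) : Type (max u v)
  | atom {n : ℕ} (P : L.Relations n) (ts : Fin n → L.Term ℕ) : PreFormula L
  | neg (φ : PreFormula L) : PreFormula L
  | half (φ : PreFormula L) : PreFormula L
  | add (φ ψ : PreFormula L) : PreFormula L
  | bigAnd (I : Set ℕ) (Φ : I → PreFormula L) : PreFormula L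
  | inf (x : ℕ) (φ : PreFormula L) : PreFormula L

namespace PreFormula

variable {L : FirstOrder.Language.{u, v}} {L' : FirstOrder.Language.{u, v}}

/-- `⋁ Φ := ¬ ⋀ ¬ φ`. -/
def bigOr (I : Set ℕ) (Φ : I → PreFormula L) : PreFormula L :=
  neg (bigAnd I fun i => neg (Φ i))

/-- `sup_x φ := ¬ inf_x ¬ φ`. -/
def sup (x : ℕ) (φ : PreFormula L) : PreFormula L := neg (inf x (neg φ))

/-- The finite disjunction `φ₁ ∨ ⋯ ∨ φ_j`. -/
def finOr (l : List (PreFormula L)) : PreFormula L :=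
  bigOr {i | i < l.length} fun i => l[i.1]'i.2

/-- `inf_{y₁} ⋯ inf_{y_i} φ`. -/
def infs (ys : List ℕ) (φ : PreFormula L) : PreFormula L := ys.foldr inf φ

/-- `sup_{x₁} ⋯ sup_{x_m} φ`. -/
def sups (xs : List ℕ) (φ : PreFormula L) : PreFormula L := xs.foldr sup φ

def freeVars : PreFormula L → Set ℕ
  | atom _ ts => ⋃ i, ((ts i).varFinset : Set ℕ)
  | neg φ => φ.freeVars
  | half φ => φ.freeVars
  | add φ ψ => φ.freeVars ∪ ψ.freeVars
  | bigAnd _ Φ => ⋃ i, (Φ i).freeVars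
  | inf x φ => φ.freeVars \ {x}

def IsSentence (φ : PreFormula L) : Prop := φ.freeVars = ∅

/-- The set of subformulas. -/
def sub : PreFormula L → Set (PreFormula L)
  | atom P ts => {atom P ts}
  | neg φ => {neg φ} ∪ φ.sub
  | half φ => {half φ} ∪ φ.sub
  | add φ ψ => {add φ ψ} ∪ φ.sub ∪ ψ.sub
  | bigAnd I Φ => {bigAnd I Φ} ∪ ⋃ i, (Φ i).sub
  | inf x φ => {inf x φ} ∪ φ.sub

/-- Translation of formulas along a map of languages. -/
def map (g : L →ᴸ L') : PreFormula L → PreFormula L'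
  | atom P ts => atom (g.onRelation P) fun i => g.onTerm (ts i)
  | neg φ => neg (φ.map g)
  | half φ => half (φ.map g)
  | add φ ψ => add (φ.map g) (ψ.map g)
  | bigAnd I Φ => bigAnd I fun i => (Φ i).map g
  | inf x φ => inf x (φ.map g)

/-- Simultaneous replacement of the free occurrences of each variable `x` by the term `s x`. -/
def subst : PreFormula L → (ℕ → L.Term ℕ) → PreFormula L
  | atom P ts, s => atom P fun i => (ts i).subst s
  | neg φ, s => neg (φ.subst s)
  | half φ, s => half (φ.subst s)
  | add φ ψ, s => add (φ.subst s) (ψ.subst s)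
  | bigAnd I Φ, s => bigAnd I fun i => (Φ i).subst s
  | inf x φ, s => inf x (φ.subst (Function.update s x (FirstOrder.Language.Term.var x)))

/-- The term `τ` can be substituted for `x` in the formula without capture of variables. -/
def FreeFor (τ : L.Term ℕ) (x : ℕ) : PreFormula L → Prop
  | atom _ _ => True
  | neg φ => φ.FreeFor τ x
  | half φ => φ.FreeFor τ x
  | add φ ψ => φ.FreeFor τ x ∧ ψ.FreeFor τ x
  | bigAnd _ Φ => ∀ i, (Φ i).FreeFor τ x
  | inf y φ => x ∉ (inf y φ).freeVars ∨ (y ∉ τ.varFinset ∧ φ.FreeFor τ x)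

end PreFormula

/-! ### Uniform continuity moduli of terms and formulas -/

/-- A modulus, extended to `(0,∞]` by the convention `δ(∞) = ∞`. -/
noncomputable def extMod (δ : ℝ → ℝ≥0∞) (e : ℝ≥0∞) : ℝ≥0∞ :=
  if e = ⊤ then ⊤ else δ e.toReal

/-- The modulus at `ε` of a symbol with moduli `δs i`, applied to terms with moduli `δt i`:
`sup_{ε₀ + ⋯ + ε_{n-1} < ε} min_i δt i (δs i ε_i)`, the `ε_i` being positive. -/
noncomputable def appMod {n : ℕ} (δs : Fin n → ℝ → ℝ≥0∞) (δt : Fin n → ℝ → ℝ≥0∞)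
    (ε : ℝ) : ℝ≥0∞ :=
  ⨆ e ∈ {e : Fin n → ℝ | (∀ i, 0 < e i) ∧ ∑ i, e i < ε}, ⨅ i, extMod (δt i) (δs i (e i))

/-- The modulus `δ_{τ,x}` of the term `τ` with respect to the variable `x`. -/
noncomputable def termMod (L : Signature.{u, v}) (x : ℕ) : L.toLanguage.Term ℕ → ℝ → ℝ≥0∞
  | .var y => if y = x then ENNReal.ofReal else fun _ => ⊤
  | .func f ts => appMod (L.modFun f) fun i => termMod L x (ts i)

/-- The modulus `δ_{φ,x}` of the formula `φ` with respect to the variable `x`. -/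
noncomputable def formMod (L : Signature.{u, v}) (x : ℕ) : PreFormula L.toLanguage → ℝ → ℝ≥0∞
  | .atom P ts => appMod (L.modRel P) fun i => termMod L x (ts i)
  | .neg φ => formMod L x φ
  | .half φ => fun ε => formMod L x φ (2 * ε)
  | .add φ ψ => fun ε =>
      ⨆ e ∈ {e : ℝ × ℝ | 0 < e.1 ∧ 0 < e.2 ∧ e.1 + e.2 < ε},
        min (formMod L x φ e.1) (formMod L x ψ e.2)
  | .bigAnd _ Φ => fun ε => ⨆ ε' ∈ Set.Ioo (0 : ℝ) ε, ⨅ i, formMod L x (Φ i) ε'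
  | .inf y φ => if y = x then fun _ => ⊤ else formMod L x φ

/-- `φ` is a formula of `L_{ω₁,ω}`: every infinitary conjunction `⋀ Φ` in it is of formulas in a
common finite tuple of free variables such that `inf_{φ ∈ Φ} δ_{φ,x}(ε) > 0` for all `ε > 0` and
all `x` in the tuple. -/
def IsFormula (L : Signature.{u, v}) : PreFormula L.toLanguage → Prop
  | .atom _ _ => True
  | .neg φ => IsFormula L φ
  | .half φ => IsFormula L φ
  | .add φ ψ => IsFormula L φ ∧ IsFormula L ψ
  | .bigAnd _ Φ => (∀ i, IsFormula L (Φ i)) ∧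
      ∃ xs : Finset ℕ, (∀ i, (Φ i).freeVars ⊆ xs) ∧
        ∀ x ∈ xs, ∀ ε : ℝ, 0 < ε → 0 < ⨅ i, formMod L x (Φ i) ε
  | .inf _ φ => IsFormula L φ

/-! ### Semantics -/

namespace MetricStructure

variable {L : Signature.{u, v}}

def termVal (M : MetricStructure.{u, v, w} L) (s : ℕ → M.carrier) :
    L.toLanguage.Term ℕ → M.carrier
  | .var x => s x
  | .func f ts => M.funMap f fun i => M.termVal s (ts i)

/-- The value of a formula under an assignment `s` of the variables. Infima are taken in `[0,1]`,
and `r ∔ t = min (r + t) 1`. -/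
noncomputable def eval (M : MetricStructure.{u, v, w} L) :
    PreFormula L.toLanguage → (ℕ → M.carrier) → unitInterval
  | .atom P ts, s => M.relMap P fun i => M.termVal s (ts i)
  | .neg φ, s => unitInterval.symm (M.eval φ s)
  | .half φ, s => Set.projIcc 0 1 zero_le_one ((M.eval φ s : ℝ) / 2)
  | .add φ ψ, s => Set.projIcc 0 1 zero_le_one ((M.eval φ s : ℝ) + M.eval ψ s)
  | .bigAnd _ Φ, s => ⨅ i, M.eval (Φ i) s
  | .inf x φ, s => ⨅ a : M.carrier, M.eval φ (Function.update s x a)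

/-- The value `φ^M` of a sentence; for a sentence the assignment is irrelevant. -/
noncomputable def value (M : MetricStructure.{u, v, w} L) (φ : PreFormula L.toLanguage) : ℝ :=
  M.eval φ fun _ => Classical.arbitrary M.carrier

end MetricStructure

/-! ### Fragments -/

/-- A fragment of `L_{ω₁,ω}`: a set of formulas that contains all atomic formulas and is closed
under subformulas and (as far as the result is a formula of `L_{ω₁,ω}`) under capture-free
substitution of a term for a free variable. -/
structure IsFragment (L : Signature.{u, v}) (A : Set (PreFormula L.toLanguage)) : Prop where
  isFormula : ∀ φ ∈ A, IsFormula L φ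
  atom_mem : ∀ {n : ℕ} (P : L.Relations n) (ts : Fin n → L.toLanguage.Term ℕ),
    PreFormula.atom P ts ∈ A
  sub_subset : ∀ φ ∈ A, φ.sub ⊆ A
  subst_mem : ∀ φ ∈ A, ∀ (x : ℕ) (τ : L.toLanguage.Term ℕ), φ.FreeFor τ x →
    IsFormula L (φ.subst (Function.update FirstOrder.Language.Term.var x τ)) →
      φ.subst (Function.update FirstOrder.Language.Term.var x τ) ∈ A

/-- `S` is a class of formulas of the fragment `A` that contains all atomic formulas and is
closed under subformulas. -/
structure IsSubclass (L : Signature.{u, v}) (A S : Set (PreFormula L.toLanguage)) : Prop where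
  subset : S ⊆ A
  atom_mem : ∀ {n : ℕ} (P : L.Relations n) (ts : Fin n → L.toLanguage.Term ℕ),
    PreFormula.atom P ts ∈ S
  sub_subset : ∀ φ ∈ S, φ.sub ⊆ S

/-! ### New constants; the set `C = {c_i | i < ω}` is indexed by `ℕ` -/

/-- An `L(C)`-structure is canonical if the interpretations of the constants `c_i` are dense. -/
def MetricStructure.IsCanonical {L : Signature.{u, v}}
    (M : MetricStructure.{u, v, w} (L.addConst ℕ)) : Prop :=
  DenseRange fun i : ℕ => M.funMap (n := 0) (L.toLanguage.con i) Fin.elim0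

/-- An `L`-formula regarded as an `L(K)`-formula. -/
def PreFormula.lift {L : Signature.{u, v}} (K : Type) (φ : PreFormula L.toLanguage) :
    PreFormula (L.addConst K).toLanguage :=
  φ.map (L.toLanguage.lhomWithConstants K)

/-- An `L(C₀)`-formula, `C₀ ⊆ C`, regarded as an `L(C)`-formula. -/
def PreFormula.inclusion {L : Signature.{u, v}} {C₀ : Finset ℕ}
    (φ : PreFormula (L.addConst C₀).toLanguage) : PreFormula (L.addConst ℕ).toLanguage :=
  φ.map (L.toLanguage.lhomWithConstantsMap (Subtype.val : C₀ → ℕ))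

/-- The `L(C)`-formula obtained from `φ` by replacing each free variable `x` for which
`s x = some i` with the constant `c_i`. -/
def PreFormula.instConst {L : Signature.{u, v}} (φ : PreFormula L.toLanguage)
    (s : ℕ → Option ℕ) : PreFormula (L.addConst ℕ).toLanguage :=
  (φ.lift ℕ).subst fun x => (s x).elim (FirstOrder.Language.Term.var x)
    fun i => FirstOrder.Language.Constants.term (L.toLanguage.con i)

/-- `φ(c̄)`, for a tuple of variables `xs` and a tuple `cs` of constants. -/
def PreFormula.atConsts {L : Signature.{u, v}} (φ : PreFormula L.toLanguage) (xs cs : List ℕ) :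
    PreFormula (L.addConst ℕ).toLanguage :=
  φ.instConst fun x => (xs.zip cs).lookup x

/-- `Σ(C)`: the formulas obtained from members of `Σ` by replacing some of their (finitely many)
free variables with constants from `C`. -/
def withC {L : Signature.{u, v}} (S : Set (PreFormula L.toLanguage)) :
    Set (PreFormula (L.addConst ℕ).toLanguage) :=
  {θ | ∃ φ ∈ S, ∃ s : ℕ → Option ℕ, θ = φ.instConst s}

/-- A set of inequalities `φ < r` between `L(C)`-sentences and reals (coded as pairs `(φ, r)`) is
satisfiable in the class `𝓜` if for some `M ∈ 𝓜`, some finite `C₀ ⊆ C` and some interpretation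
`a` of the constants in `C₀`, all the `φ` are sentences of `L(C₀)` and all the inequalities hold
in `(M, a_c)_{c ∈ C₀}`. -/
def Satisfiable {L : Signature.{u, v}} (𝓜 : Set (MetricStructure.{u, v, w} L))
    (Γ : Set (PreFormula (L.addConst ℕ).toLanguage × ℝ)) : Prop :=
  ∃ M ∈ 𝓜, ∃ (C₀ : Finset ℕ) (a : C₀ → M.carrier), ∀ γ ∈ Γ,
    ∃ θ : PreFormula (L.addConst C₀).toLanguage,
      θ.inclusion = γ.1 ∧ θ.IsSentence ∧ (M.expand a).value θ < γ.2

/-- A finite `Σ`-piece of `𝓜`: a finite set of inequalities `φ < r`, with `φ` a sentence of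
`Σ(C)`, that is satisfiable in `𝓜`. -/
def IsPiece {L : Signature.{u, v}} (S : Set (PreFormula L.toLanguage))
    (𝓜 : Set (MetricStructure.{u, v, w} L))
    (p : Set (PreFormula (L.addConst ℕ).toLanguage × ℝ)) : Prop :=
  p.Finite ∧ (∀ γ ∈ p, γ.1 ∈ withC S ∧ γ.1.IsSentence) ∧ Satisfiable 𝓜 p

/-! ### `sup ⋀ inf`-formulas -/

/-- `⋀_{k<ω} inf_{ȳ_k} (σ_{k,1} ∨ ⋯ ∨ σ_{k,j(k)})`. -/
def andInf {L : FirstOrder.Language.{u, v}} (ys : ℕ → List ℕ) (σ : ℕ → List (PreFormula L)) :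
    PreFormula L :=
  PreFormula.bigAnd Set.univ fun k => PreFormula.infs (ys k) (PreFormula.finOr (σ k))

/-- A `sup ⋀ inf`-formula over `S`:
`sup_{x̄} ⋀_{k<ω} inf_{ȳ_k} (σ_{k,1}(x̄,ȳ_k) ∨ ⋯ ∨ σ_{k,j(k)}(x̄,ȳ_k))`, a formula of the fragment
`A` with all the `σ_{k,ν}` in `S`. -/
structure SupAndInf (L : Signature.{u, v}) (A S : Set (PreFormula L.toLanguage)) where
  xs : List ℕ
  ys : ℕ → List ℕ
  σ : ℕ → List (PreFormula L.toLanguage)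
  nodup : ∀ k, (xs ++ ys k).Nodup
  σ_mem : ∀ k, ∀ φ ∈ σ k, φ ∈ S
  σ_freeVars : ∀ k, ∀ φ ∈ σ k, ∀ x ∈ φ.freeVars, x ∈ xs ++ ys k
  mem : PreFormula.sups xs (andInf ys σ) ∈ A

namespace SupAndInf

variable {L : Signature.{u, v}} {A S : Set (PreFormula L.toLanguage)}

/-- The part `ψ(x̄)` of `φ = sup_{x̄} ψ(x̄)`. -/
def psi (F : SupAndInf L A S) : PreFormula L.toLanguage := andInf F.ys F.σ

def phi (F : SupAndInf L A S) : PreFormula L.toLanguage := PreFormula.sups F.xs F.psi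

end SupAndInf

end ContLogic

open ContLogic

/-! The model is built by forcing with finite conditions. A condition is a finite set of
inequalities `φ(c̄) < r`, with `φ` in `S`, that holds in some member of `𝓜` under some
interpretation of the constants. Three kinds of requirement are dense. An infimum (conjunction or
quantifier) not decided to be at least the rational `q` gets a conjunct or a constant with value
below `q` (`isCofinal_witnesses`). Every term comes within `q` of a constant (`isCofinal_term`). For
each `n` and `c̄` there are `k` and constants `d̄` with all `σ_{n,k,ν}(c̄,d̄) < r_n`
(`isCofinal_forced`); this is where the satisfiability assumption enters. There are countably many
requirements, so a generic family of conditions meets them all.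

The places (a structure with an interpretation of the constants) at which the generic conditions
hold generate a proper filter; extend it to an ultrafilter. The limits of the metric and the
predicates along it define a structure on terms, which is then completed. Ultralimits do not in
general commute with infinite conjunctions, and this structure has only limits of terms as points;
the generic witnesses compensate for both, so that formulas of `S` take their limit values
(`exists_canonical_limit`).

Hence `σ_{n,k,ν}(c̄,d̄) ≤ r_n` in the limit, which gives `ψ_n(c̄) ≤ r_n` for every tuple of
constants. The constants are dense and formulas are continuous, so the supremum is at most `r_n` too
(`eval_sups_le`). -/

namespace ContLogic

open Filter Topology UniformSpace

/-! ### Changing several coordinates one at a time -/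

/-- Triangle inequality along a chain from `a` to `b` changing one coordinate at a time. When
coordinate `i` is changed, the current point still agrees with `a` there, so only such `c` matter.
-/
theorem dist_le_sum_of_update {ι D E : Type*} [Fintype ι] [DecidableEq ι] [PseudoMetricSpace E]
    (g : (ι → D) → E) (a b : ι → D) (e : ι → ℝ)
    (h : ∀ i c, c i = a i → dist (g c) (g (Function.update c i (b i))) ≤ e i) :
    dist (g a) (g b) ≤ ∑ i, e i := by
  have key : ∀ s : Finset ι, dist (g a) (g (s.piecewise b a)) ≤ ∑ i ∈ s, e i := by
    intro s
    induction s using Finset.induction_on with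
    | empty => simp
    | insert i s hi ih =>
      rw [Finset.sum_insert hi, Finset.piecewise_insert, add_comm]
      exact (dist_triangle _ _ _).trans (add_le_add ih (h i _ (by simp [hi])))
  simpa using key Finset.univ

theorem uniformContinuous_of_update {ι D E : Type*} [Fintype ι] [DecidableEq ι]
    [PseudoMetricSpace D] [PseudoMetricSpace E] (g : (ι → D) → E) (δ : ι → ℝ → ℝ≥0∞)
    (hδ : ∀ i ε, 0 < ε → 0 < δ i ε)
    (h : ∀ i ε, 0 < ε → ∀ a b, ENNReal.ofReal (dist (a i) b) < δ i ε →
      dist (g a) (g (Function.update a i b)) ≤ ε) : UniformContinuous g := by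
  rw [Metric.uniformContinuous_iff]
  intro ε hε
  -- The `+ 1` makes the total error strictly less than `ε`, and covers an empty `ι`.
  set e : ℝ := ε / (Fintype.card ι + 1) with he
  have he0 : 0 < e := by positivity
  have hη : ∃ η > 0, ∀ i, ENNReal.ofReal η ≤ δ i e := by
    have : ∀ i, ∃ η > 0, ENNReal.ofReal η ≤ δ i e := by
      intro i
      by_cases ht : δ i e = ⊤
      · exact ⟨1, one_pos, ht ▸ le_top⟩
      · exact ⟨(δ i e).toReal, ENNReal.toReal_pos (hδ i e he0).ne' ht,
          (ENNReal.ofReal_toReal ht).le⟩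
    choose η hη0 hη using this
    obtain hι | hι := isEmpty_or_nonempty ι
    · exact ⟨1, one_pos, fun i => (hι.false i).elim⟩
    · obtain ⟨i₀, hi₀⟩ := Finite.exists_min η
      exact ⟨η i₀, hη0 i₀, fun i => (ENNReal.ofReal_le_ofReal (hi₀ i)).trans (hη i)⟩
  obtain ⟨η, hη0, hη⟩ := hη
  refine ⟨η, hη0, fun {a b} hab => ?_⟩
  refine (dist_le_sum_of_update g a b (fun _ => e) fun i c hc => h i e he0 c (b i) ?_).trans_lt ?_
  · rw [hc]
    exact ((ENNReal.ofReal_lt_ofReal_iff hη0).2 ((dist_le_pi_dist a b i).trans_lt hab)).trans_le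
      (hη i)
  · simp only [Finset.sum_const, Finset.card_univ, nsmul_eq_mul, he]
    rw [mul_div_assoc', div_lt_iff₀ (by positivity)]
    nlinarith

/-! ### Moduli of terms and formulas -/

theorem extMod_pos {δ : ℝ → ℝ≥0∞} (hδ : ∀ ε, 0 < ε → 0 < δ ε) {e : ℝ≥0∞} (he : 0 < e) :
    0 < extMod δ e := by
  unfold extMod
  split_ifs with h
  · simp
  · exact hδ _ (ENNReal.toReal_pos he.ne' h)

theorem appMod_pos {n : ℕ} {δs δt : Fin n → ℝ → ℝ≥0∞} (hs : ∀ i ε, 0 < ε → 0 < δs i ε)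
    (ht : ∀ i ε, 0 < ε → 0 < δt i ε) {ε : ℝ} (hε : 0 < ε) : 0 < appMod δs δt ε := by
  have he0 : 0 < ε / (n + 1) := by positivity
  have hmem : (fun _ : Fin n => ε / (n + 1)) ∈
      {e : Fin n → ℝ | (∀ i, 0 < e i) ∧ ∑ i, e i < ε} := by
    refine ⟨fun _ => he0, ?_⟩
    simp only [Finset.sum_const, Finset.card_univ, nsmul_eq_mul, Fintype.card_fin]
    rw [mul_div_assoc', div_lt_iff₀ (by positivity)]
    nlinarith
  refine lt_of_lt_of_le ?_ (le_iSup₂ (f := fun e (_ : e ∈ {e : Fin n → ℝ |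
    (∀ i, 0 < e i) ∧ ∑ i, e i < ε}) => ⨅ i, extMod (δt i) (δs i (e i))) _ hmem)
  obtain hn | hn := isEmpty_or_nonempty (Fin n)
  · rw [iInf_of_empty]
    exact ENNReal.zero_lt_top
  · obtain ⟨i, hi⟩ := exists_eq_ciInf_of_finite (f := fun i => extMod (δt i) (δs i (ε / (n + 1))))
    rw [← hi]
    exact extMod_pos (ht i) (hs i _ he0)

theorem lt_appMod {n : ℕ} {δs δt : Fin n → ℝ → ℝ≥0∞} {ε : ℝ} {x : ℝ≥0∞}
    (h : x < appMod δs δt ε) : ∃ e : Fin n → ℝ, (∀ i, 0 < e i) ∧ ∑ i, e i < ε ∧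
      ∀ i, x < extMod (δt i) (δs i (e i)) := by
  simp only [appMod, lt_iSup_iff] at h
  obtain ⟨e, he, h⟩ := h
  exact ⟨e, he.1, he.2, fun i => h.trans_le (iInf_le _ i)⟩

/-- Left continuity of the modulus: the constraint `∑ e i < ε` survives a small decrease of `ε`. -/
theorem exists_lt_appMod {n : ℕ} {δs δt : Fin n → ℝ → ℝ≥0∞} {ε : ℝ} {x : ℝ≥0∞} (hε : 0 < ε)
    (h : x < appMod δs δt ε) : ∃ ε', 0 < ε' ∧ ε' < ε ∧ x < appMod δs δt ε' := by
  simp only [appMod, lt_iSup_iff] at h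
  obtain ⟨e, he, h⟩ := h
  obtain ⟨ε', h₁, h₂⟩ := exists_between (max_lt hε he.2)
  refine ⟨ε', (le_max_left _ _).trans_lt h₁, h₂, ?_⟩
  simp only [appMod, lt_iSup_iff]
  exact ⟨e, ⟨he.1, (le_max_right _ _).trans_lt h₁⟩, h⟩

theorem appMod_eq_top {n : ℕ} {δs δt : Fin n → ℝ → ℝ≥0∞} (hs : ∀ i ε, 0 < ε → 0 < δs i ε)
    (ht : ∀ i ε, 0 < ε → δt i ε = ⊤) {ε : ℝ} (hε : 0 < ε) : appMod δs δt ε = ⊤ := by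
  have he0 : 0 < ε / (n + 1) := by positivity
  have hmem : (fun _ : Fin n => ε / (n + 1)) ∈
      {e : Fin n → ℝ | (∀ i, 0 < e i) ∧ ∑ i, e i < ε} := by
    refine ⟨fun _ => he0, ?_⟩
    simp only [Finset.sum_const, Finset.card_univ, nsmul_eq_mul, Fintype.card_fin]
    rw [mul_div_assoc', div_lt_iff₀ (by positivity)]
    nlinarith
  rw [eq_top_iff]
  refine le_trans ?_ (le_iSup₂ (f := fun e (_ : e ∈ {e : Fin n → ℝ |
    (∀ i, 0 < e i) ∧ ∑ i, e i < ε}) => ⨅ i, extMod (δt i) (δs i (e i))) _ hmem)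
  refine le_iInf fun i => ?_
  unfold extMod
  split_ifs with h
  · exact le_rfl
  · rw [ht i _ (ENNReal.toReal_pos (hs i _ he0).ne' h)]

variable {L : Signature.{u, v}}

theorem termMod_pos (x : ℕ) (t : L.toLanguage.Term ℕ) :
    ∀ ε, 0 < ε → 0 < termMod L x t ε := by
  induction t with
  | var y =>
    intro ε hε
    rw [termMod]
    split_ifs
    · simpa using hε
    · simp
  | func f ts ih =>
    intro ε hε
    rw [termMod]
    exact appMod_pos (fun i => L.modFun_pos f i) ih hε

theorem exists_lt_termMod (x : ℕ) (t : L.toLanguage.Term ℕ) {ε : ℝ} (hε : 0 < ε) {y : ℝ≥0∞}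
    (h : y < termMod L x t ε) : ∃ ε', 0 < ε' ∧ ε' < ε ∧ y < termMod L x t ε' := by
  cases t with
  | var z =>
    rw [termMod] at h ⊢
    split_ifs at h ⊢
    · have hy : y ≠ ⊤ := (h.trans_le le_top).ne
      rw [← ENNReal.ofReal_toReal hy, ENNReal.ofReal_lt_ofReal_iff hε] at h
      obtain ⟨ε', h₁, h₂⟩ := exists_between h
      have h0 : 0 < ε' := ENNReal.toReal_nonneg.trans_lt h₁
      refine ⟨ε', h0, h₂, ?_⟩
      rw [← ENNReal.ofReal_toReal hy]
      exact (ENNReal.ofReal_lt_ofReal_iff h0).2 h₁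
    · exact ⟨ε / 2, by positivity, by linarith, h⟩
  | func f ts =>
    rw [termMod] at h ⊢
    exact exists_lt_appMod hε h

theorem termMod_eq_top {x : ℕ} {t : L.toLanguage.Term ℕ} (hx : x ∉ t.varFinset) :
    ∀ ε, 0 < ε → termMod L x t ε = ⊤ := by
  induction t with
  | var y =>
    intro ε hε
    rw [termMod, if_neg]
    rintro rfl
    simp [FirstOrder.Language.Term.varFinset] at hx
  | func f ts ih =>
    intro ε hε
    rw [termMod]
    refine appMod_eq_top (fun i => L.modFun_pos f i) (fun i => ih i fun h => hx ?_) hε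
    simp only [FirstOrder.Language.Term.varFinset, Finset.mem_biUnion]
    exact ⟨i, Finset.mem_univ _, h⟩

/-- `IsFormula` controls only the variables of the common tuple of a conjunction; infinite moduli
for all other variables let `formMod_pos` hold without restriction. -/
theorem formMod_eq_top {x : ℕ} (φ : PreFormula L.toLanguage) (hx : x ∉ φ.freeVars) :
    ∀ ε, 0 < ε → formMod L x φ ε = ⊤ := by
  induction φ with
  | atom P ts =>
    intro ε hε
    rw [formMod]
    refine appMod_eq_top (fun i => L.modRel_pos P i) (fun i => termMod_eq_top fun h => hx ?_) hε
    exact Set.mem_iUnion.2 ⟨i, h⟩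
  | neg φ ih => exact ih hx
  | half φ ih => exact fun ε hε => ih hx _ (by positivity)
  | add φ ψ ihφ ihψ =>
    intro ε hε
    rw [PreFormula.freeVars, Set.mem_union, not_or] at hx
    rw [formMod, eq_top_iff]
    refine le_iSup₂_of_le (ε / 3, ε / 3)
      ⟨by positivity, by positivity, by dsimp only; linarith⟩ ?_
    rw [ihφ hx.1 _ (by positivity), ihψ hx.2 _ (by positivity), min_self]
  | bigAnd I Φ ih =>
    intro ε hε
    rw [PreFormula.freeVars, Set.mem_iUnion, not_exists] at hx
    rw [formMod, eq_top_iff]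
    refine le_iSup₂_of_le (ε / 2) ⟨by positivity, by linarith⟩ (le_iInf fun i => ?_)
    rw [ih i (hx i) _ (by positivity)]
  | inf y φ ih =>
    intro ε hε
    rw [formMod]
    split_ifs with h
    · rfl
    · exact ih (fun hφ => hx ⟨hφ, fun h' => h h'.symm⟩) ε hε

theorem formMod_pos (x : ℕ) (φ : PreFormula L.toLanguage) (hφ : IsFormula L φ) :
    ∀ ε, 0 < ε → 0 < formMod L x φ ε := by
  induction φ with
  | atom P ts =>
    intro ε hε
    rw [formMod]
    exact appMod_pos (fun i => L.modRel_pos P i) (fun i => termMod_pos x (ts i)) hε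
  | neg φ ih => exact ih hφ
  | half φ ih => exact fun ε hε => ih hφ _ (by positivity)
  | add φ ψ ihφ ihψ =>
    intro ε hε
    rw [formMod]
    refine lt_of_lt_of_le ?_ (le_iSup₂_of_le (ε / 3, ε / 3)
      ⟨by positivity, by positivity, by dsimp only; linarith⟩ le_rfl)
    exact lt_min (ihφ hφ.1 _ (by positivity)) (ihψ hφ.2 _ (by positivity))
  | bigAnd I Φ ih =>
    intro ε hε
    obtain ⟨-, xs, hfv, hpos⟩ := hφ
    rw [formMod]
    refine lt_of_lt_of_le ?_ (le_iSup₂_of_le (ε / 2) ⟨by positivity, by linarith⟩ le_rfl)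
    by_cases hx : x ∈ xs
    · exact hpos x hx _ (by positivity)
    · refine lt_of_lt_of_le ENNReal.zero_lt_top (le_iInf fun i => ?_)
      rw [formMod_eq_top (Φ i) (fun h => hx (hfv i h)) _ (by positivity)]
  | inf y φ ih =>
    intro ε hε
    rw [formMod]
    split_ifs with h
    · simp
    · exact ih hφ ε hε

/-! ### Moduli are respected -/

/-- Here `y` measures the change of the variable. The moduli `δt` only yield `≤` for the arguments,
while `δs` asks for `<`; the left continuity `hδt` bridges the gap. -/
theorem dist_app_le {n : ℕ} {δs δt : Fin n → ℝ → ℝ≥0∞} {D E : Type*} [PseudoMetricSpace D]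
    [PseudoMetricSpace E] (g : (Fin n → D) → E)
    (hs : ∀ i ε, 0 < ε → 0 < δs i ε)
    (hg : ∀ i ε, 0 < ε → ∀ a b, ENNReal.ofReal (dist (a i) b) < δs i ε →
      dist (g a) (g (Function.update a i b)) ≤ ε)
    {y : ℝ≥0∞} (a b : Fin n → D)
    (hab : ∀ i ε, 0 < ε → y < δt i ε → dist (a i) (b i) ≤ ε)
    (hδt : ∀ i ε, 0 < ε → y < δt i ε → ∃ ε', 0 < ε' ∧ ε' < ε ∧ y < δt i ε')
    {ε : ℝ} (h : y < appMod δs δt ε) : dist (g a) (g b) ≤ ε := by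
  obtain ⟨e, he0, hsum, he⟩ := lt_appMod h
  refine (dist_le_sum_of_update g a b e fun i c hc => hg i _ (he0 i) _ _ ?_).trans hsum.le
  rw [hc]
  by_cases ht : δs i (e i) = ⊤
  · rw [ht]; exact ENNReal.ofReal_lt_top
  · have hpos := ENNReal.toReal_pos (hs i _ (he0 i)).ne' ht
    have hi := he i
    rw [extMod, if_neg ht] at hi
    obtain ⟨ε', h0, h1, h2⟩ := hδt i _ hpos hi
    rw [← ENNReal.ofReal_toReal ht]
    exact (ENNReal.ofReal_lt_ofReal_iff hpos).2 ((hab i ε' h0 h2).trans_lt h1)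

namespace MetricStructure

variable (M : MetricStructure.{u, v, w} L)

theorem dist_termVal_le (x : ℕ) (t : L.toLanguage.Term ℕ) :
    ∀ ε, 0 < ε → ∀ (s : ℕ → M.carrier) (b : M.carrier),
      ENNReal.ofReal (dist (s x) b) < termMod L x t ε →
        dist (M.termVal s t) (M.termVal (Function.update s x b) t) ≤ ε := by
  induction t with
  | var y =>
    intro ε hε s b h
    rw [termMod] at h
    simp only [termVal]
    split_ifs at h with hy
    · subst hy
      rw [Function.update_self]
      exact ((ENNReal.ofReal_lt_ofReal_iff hε).1 h).le
    · rw [Function.update_of_ne hy, dist_self]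
      exact hε.le
  | func f ts ih =>
    intro ε hε s b h
    rw [termMod] at h
    exact dist_app_le (M.funMap f) (fun i => L.modFun_pos f i) (M.funMap_mod f) _ _
      (fun i ε' hε' hy => ih i ε' hε' s b hy) (fun i ε' hε' => exists_lt_termMod x (ts i) hε') h

theorem dist_iInf_le {ι : Sort*} (f g : ι → unitInterval) {ε : ℝ} (hε : 0 ≤ ε)
    (h : ∀ i, dist (f i) (g i) ≤ ε) : dist (⨅ i, f i) (⨅ i, g i) ≤ ε := by
  have key : ∀ f g : ι → unitInterval, (∀ i, dist (f i) (g i) ≤ ε) →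
      ((⨅ i, f i : unitInterval) : ℝ) - (⨅ i, g i : unitInterval) ≤ ε := by
    intro f g h
    by_contra! hlt
    have h0 := (⨅ i, f i : unitInterval).2
    have h1 := (⨅ i, g i : unitInterval).2
    -- The number `(⨅ i, f i) - ε` lies in `[0,1]`: it exceeds `⨅ i, g i`, and `0 ≤ ε`.
    have hlt' : (⨅ i, g i) <
        (⟨(⨅ i, f i : unitInterval) - ε, by linarith [h1.1], by linarith [h0.2]⟩ : unitInterval) :=
      Subtype.coe_lt_coe.1 (by dsimp only; linarith)
    obtain ⟨i, hi⟩ := iInf_lt_iff.1 hlt'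
    have h2 : ((⨅ i, f i : unitInterval) : ℝ) ≤ f i := Subtype.coe_le_coe.2 (iInf_le f i)
    have h3 : (g i : ℝ) < (⨅ i, f i : unitInterval) - ε := Subtype.coe_lt_coe.2 hi
    have h4 := (le_abs_self _).trans (h i)
    linarith
  rw [Subtype.dist_eq, Real.dist_eq, abs_le]
  have h1 := key g f fun i => by rw [dist_comm]; exact h i
  have h2 := key f g h
  constructor <;> linarith

theorem dist_eval_le (x : ℕ) (φ : PreFormula L.toLanguage) :
    ∀ ε, 0 < ε → ∀ (s : ℕ → M.carrier) (b : M.carrier),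
      ENNReal.ofReal (dist (s x) b) < formMod L x φ ε →
        dist (M.eval φ s) (M.eval φ (Function.update s x b)) ≤ ε := by
  induction φ with
  | atom P ts =>
    intro ε hε s b h
    rw [formMod] at h
    exact dist_app_le (M.relMap P) (fun i => L.modRel_pos P i) (M.relMap_mod P) _ _
      (fun i ε' hε' hy => M.dist_termVal_le x (ts i) ε' hε' s b hy)
      (fun i ε' hε' => exists_lt_termMod x (ts i) hε') h
  | neg φ ih =>
    intro ε hε s b h
    have := ih ε hε s b h
    rw [Subtype.dist_eq, Real.dist_eq] at this ⊢
    simp only [eval, unitInterval.coe_symm_eq]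
    rw [abs_sub_comm] at this
    convert this using 2
    ring
  | half φ ih =>
    intro ε hε s b h
    have := ih (2 * ε) (by positivity) s b h
    rw [Subtype.dist_eq, Real.dist_eq] at this
    refine ((LipschitzWith.projIcc (zero_le_one (α := ℝ))).dist_le_mul _ _).trans ?_
    rw [NNReal.coe_one, one_mul, Real.dist_eq, ← sub_div, abs_div, abs_two]
    linarith
  | add φ ψ ihφ ihψ =>
    intro ε hε s b h
    simp only [formMod, lt_iSup_iff] at h
    obtain ⟨e, ⟨h1, h2, h3⟩, h⟩ := h
    have hφ := ihφ _ h1 s b (h.trans_le (min_le_left _ _))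
    have hψ := ihψ _ h2 s b (h.trans_le (min_le_right _ _))
    rw [Subtype.dist_eq, Real.dist_eq] at hφ hψ
    refine ((LipschitzWith.projIcc (zero_le_one (α := ℝ))).dist_le_mul _ _).trans ?_
    rw [NNReal.coe_one, one_mul, Real.dist_eq, add_sub_add_comm]
    exact (abs_add_le _ _).trans (by linarith)
  | bigAnd I Φ ih =>
    intro ε hε s b h
    simp only [formMod, lt_iSup_iff] at h
    obtain ⟨ε', hε', h⟩ := h
    exact (dist_iInf_le _ _ hε'.1.le fun i => ih i ε' hε'.1 s b (h.trans_le (iInf_le _ i))).trans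
      hε'.2.le
  | inf y φ ih =>
    intro ε hε s b h
    rw [formMod] at h
    refine dist_iInf_le _ _ hε.le fun a => ?_
    split_ifs at h with hy
    · subst hy
      rw [Function.update_idem, dist_self]
      exact hε.le
    · rw [Function.update_comm (Ne.symm hy)]
      refine ih ε hε (Function.update s y a) b ?_
      rwa [Function.update_of_ne (Ne.symm hy)]

/-- Continuity in a single variable is enough, since the passage from constants to arbitrary points
is made for one quantifier at a time. -/
theorem continuous_eval_update {φ : PreFormula L.toLanguage} (hφ : IsFormula L φ)
    (s : ℕ → M.carrier) (x : ℕ) : Continuous fun b => M.eval φ (Function.update s x b) := by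
  rw [Metric.continuous_iff]
  intro b ε hε
  have hpos := formMod_pos x φ hφ (ε / 2) (by positivity)
  have hlim : Tendsto (fun a : M.carrier => ENNReal.ofReal (dist b a)) (𝓝 b) (𝓝 0) := by
    have : Continuous fun a : M.carrier => ENNReal.ofReal (dist b a) :=
      ENNReal.continuous_ofReal.comp (continuous_const.dist continuous_id)
    simpa using this.tendsto b
  obtain ⟨δ, hδ, hball⟩ := Metric.eventually_nhds_iff.1 (hlim.eventually_lt_const hpos)
  refine ⟨δ, hδ, fun a ha => ?_⟩
  have := M.dist_eval_le x φ (ε / 2) (by positivity) (Function.update s x b) a (by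
    rw [Function.update_self]; exact hball ha)
  rw [Function.update_idem, dist_comm] at this
  linarith

/-! ### Dependence on free variables -/

theorem termVal_congr (t : L.toLanguage.Term ℕ) {s s' : ℕ → M.carrier}
    (h : ∀ x ∈ t.varFinset, s x = s' x) : M.termVal s t = M.termVal s' t := by
  induction t with
  | var y => exact h y (by simp [FirstOrder.Language.Term.varFinset])
  | func f ts ih =>
    simp only [termVal]
    congr 1
    funext i
    refine ih i fun x hx => h x ?_
    simp only [FirstOrder.Language.Term.varFinset, Finset.mem_biUnion]
    exact ⟨i, Finset.mem_univ _, hx⟩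

theorem eval_congr (φ : PreFormula L.toLanguage) : ∀ {s s' : ℕ → M.carrier},
    (∀ x ∈ φ.freeVars, s x = s' x) → M.eval φ s = M.eval φ s' := by
  induction φ with
  | atom P ts =>
    intro s s' h
    simp only [eval]
    congr 1
    funext i
    exact M.termVal_congr _ fun x hx => h x (Set.mem_iUnion.2 ⟨i, hx⟩)
  | neg φ ih => intro s s' h; simp only [eval]; rw [ih h]
  | half φ ih => intro s s' h; simp only [eval]; rw [ih h]
  | add φ ψ ihφ ihψ =>
    intro s s' h
    simp only [eval]
    rw [ihφ fun x hx => h x (Or.inl hx), ihψ fun x hx => h x (Or.inr hx)]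
  | bigAnd I Φ ih =>
    intro s s' h
    simp only [eval]
    exact iInf_congr fun i => ih i fun x hx => h x (Set.mem_iUnion.2 ⟨i, hx⟩)
  | inf y φ ih =>
    intro s s' h
    simp only [eval]
    refine iInf_congr fun a => ih fun x hx => ?_
    by_cases hxy : x = y
    · subst hxy; simp
    · rw [Function.update_of_ne hxy, Function.update_of_ne hxy]
      exact h x ⟨hx, hxy⟩

end MetricStructure

/-- The common finite tuple of each conjunction is what keeps this finite; it guarantees that fresh
constants exist. -/
theorem IsFormula.finite_freeVars {φ : PreFormula L.toLanguage} (hφ : IsFormula L φ) :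
    φ.freeVars.Finite := by
  induction φ with
  | atom P ts => exact Set.finite_iUnion fun i => Finset.finite_toSet _
  | neg φ ih => exact ih hφ
  | half φ ih => exact ih hφ
  | add φ ψ ihφ ihψ => exact (ihφ hφ.1).union (ihψ hφ.2)
  | bigAnd I Φ ih =>
    obtain ⟨-, xs, hfv, -⟩ := hφ
    exact xs.finite_toSet.subset (Set.iUnion_subset hfv)
  | inf y φ ih => exact (ih hφ).subset Set.sdiff_subset

/-! ### Constants in place of free variables -/

/-- Replace the free variable `x` by the constant `t x`, if there is one. -/
def PreFormula.inst {K : Type} (φ : PreFormula L.toLanguage) (t : ℕ → Option K) :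
    PreFormula (L.addConst K).toLanguage :=
  (φ.lift K).subst fun x => (t x).elim (FirstOrder.Language.Term.var x)
    fun i => FirstOrder.Language.Constants.term (L.toLanguage.con i)

theorem PreFormula.inst_inf {K : Type} (y : ℕ) (φ : PreFormula L.toLanguage)
    (t : ℕ → Option K) :
    (PreFormula.inf y φ).inst t = .inf y (φ.inst (Function.update t y none)) := by
  refine congrArg (fun σ => PreFormula.inf y ((φ.lift K).subst σ)) (funext fun x => ?_)
  by_cases hx : x = y
  · subst hx; simp
  · simp [Function.update_of_ne hx]

theorem PreFormula.inst_congr {K : Type} (φ : PreFormula L.toLanguage) :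
    ∀ {t t' : ℕ → Option K}, (∀ x ∈ φ.freeVars, t x = t' x) → φ.inst t = φ.inst t' := by
  induction φ with
  | atom P ts =>
    intro t t' h
    unfold PreFormula.inst PreFormula.lift
    simp only [PreFormula.map, PreFormula.subst]
    congr 1
    funext i
    have hi : ∀ x ∈ (ts i).varFinset, t x = t' x := fun x hx => h x (Set.mem_iUnion.2 ⟨i, hx⟩)
    generalize ts i = τ at hi
    induction τ with
    | var y => simp [Language.LHom.onTerm, Language.Term.subst,
        hi y (by simp [Language.Term.varFinset])]
    | func f ts ih =>
      simp only [Language.LHom.onTerm, Language.Term.subst]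
      congr 1
      funext j
      refine ih j fun x hx => hi x ?_
      simp only [Language.Term.varFinset, Finset.mem_biUnion]
      exact ⟨j, Finset.mem_univ _, hx⟩
  | neg φ ih => intro t t' h; exact congrArg PreFormula.neg (ih h)
  | half φ ih => intro t t' h; exact congrArg PreFormula.half (ih h)
  | add φ ψ ihφ ihψ =>
    intro t t' h
    exact congrArg₂ PreFormula.add (ihφ fun x hx => h x (Or.inl hx))
      (ihψ fun x hx => h x (Or.inr hx))
  | bigAnd I Φ ih =>
    intro t t' h
    exact congrArg (PreFormula.bigAnd I)
      (funext fun i => ih i fun x hx => h x (Set.mem_iUnion.2 ⟨i, hx⟩))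
  | inf y φ ih =>
    intro t t' h
    rw [inst_inf, inst_inf, ih]
    intro x hx
    by_cases hxy : x = y
    · subst hxy; simp
    · rw [Function.update_of_ne hxy, Function.update_of_ne hxy]
      exact h x ⟨hx, hxy⟩

theorem PreFormula.freeVars_inst {K : Type} (φ : PreFormula L.toLanguage) :
    ∀ t : ℕ → Option K, (φ.inst t).freeVars ⊆ {x | x ∈ φ.freeVars ∧ t x = none} := by
  induction φ with
  | atom P ts =>
    intro t x hx
    unfold PreFormula.inst PreFormula.lift at hx
    simp only [PreFormula.map, PreFormula.subst, PreFormula.freeVars, Set.mem_iUnion,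
      Finset.mem_coe] at hx
    obtain ⟨i, hx⟩ := hx
    suffices h : x ∈ (ts i).varFinset ∧ t x = none from
      ⟨Set.mem_iUnion.2 ⟨i, h.1⟩, h.2⟩
    generalize ts i = τ at hx
    induction τ with
    | var y =>
      simp only [Language.LHom.onTerm, Language.Term.subst] at hx
      cases hy : t y with
      | none =>
        rw [hy] at hx
        simp only [Option.elim, Language.Term.varFinset, Finset.mem_singleton] at hx
        subst hx
        exact ⟨by simp [Language.Term.varFinset], hy⟩
      | some i =>
        rw [hy] at hx
        simp [Language.Constants.term, Language.Term.varFinset] at hx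
    | func f ts ih =>
      simp only [Language.LHom.onTerm, Language.Term.subst, Language.Term.varFinset,
        Finset.mem_biUnion] at hx ⊢
      obtain ⟨j, -, hx⟩ := hx
      exact ⟨⟨j, Finset.mem_univ _, (ih j hx).1⟩, (ih j hx).2⟩
  | neg φ ih => exact ih
  | half φ ih => exact ih
  | add φ ψ ihφ ihψ =>
    rintro t x (hx | hx)
    · exact ⟨Or.inl (ihφ t hx).1, (ihφ t hx).2⟩
    · exact ⟨Or.inr (ihψ t hx).1, (ihψ t hx).2⟩
  | bigAnd I Φ ih =>
    intro t x hx
    obtain ⟨i, hx⟩ := Set.mem_iUnion.1 hx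
    exact ⟨Set.mem_iUnion.2 ⟨i, (ih i t hx).1⟩, (ih i t hx).2⟩
  | inf y φ ih =>
    intro t x hx
    rw [inst_inf] at hx
    have hxy : x ≠ y := hx.2
    have := ih _ hx.1
    rw [Set.mem_ofPred_eq, Function.update_of_ne hxy] at this
    exact ⟨⟨this.1, hxy⟩, this.2⟩

/-- Exhibits an instance over `C` as coming from a finite sublanguage, as `Satisfiable` demands. -/
theorem PreFormula.inclusion_inst {C₀ : Finset ℕ} (φ : PreFormula L.toLanguage) :
    ∀ t : ℕ → Option C₀, (φ.inst t).inclusion = φ.inst fun x => (t x).map Subtype.val := by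
  induction φ with
  | atom P ts =>
    intro t
    unfold PreFormula.inclusion PreFormula.inst PreFormula.lift
    simp only [PreFormula.map, PreFormula.subst]
    congr 1
    funext i
    generalize ts i = τ
    induction τ with
    | var y =>
      simp only [Language.LHom.onTerm, Language.Term.subst]
      cases t y with
      | none => rfl
      | some i =>
        simp only [Option.map_some, Option.elim_some, Language.Constants.term,
          Language.LHom.onTerm]
        refine congrArg₂ Language.Term.func rfl (funext fun j => j.elim0)
    | func f ts ih =>
      simp only [Language.LHom.onTerm, Language.Term.subst]
      exact congrArg₂ Language.Term.func rfl (funext fun j => ih j)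
  | neg φ ih => exact fun t => congrArg PreFormula.neg (ih t)
  | half φ ih => exact fun t => congrArg PreFormula.half (ih t)
  | add φ ψ ihφ ihψ => exact fun t => congrArg₂ PreFormula.add (ihφ t) (ihψ t)
  | bigAnd I Φ ih => exact fun t => congrArg (PreFormula.bigAnd I) (funext fun i => ih i t)
  | inf y φ ih =>
    intro t
    rw [inst_inf, inst_inf]
    have := ih (Function.update t y none)
    refine (congrArg (PreFormula.inf y) this).trans ?_
    congr 2
    funext x
    by_cases hx : x = y
    · subst hx; simp
    · simp [Function.update_of_ne hx]

theorem elim_update {K α : Type*} (t : ℕ → Option K) (s : ℕ → α) (a : K → α) (y : ℕ) (b : α) :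
    (fun x => (Function.update t y none x).elim (Function.update s y b x) a) =
      Function.update (fun x => (t x).elim (s x) a) y b := by
  funext x
  by_cases hx : x = y
  · subst hx; simp
  · simp [Function.update_of_ne hx]

namespace MetricStructure

variable (M : MetricStructure.{u, v, w} L)

theorem termVal_expand_inst {K : Type} (a : K → M.carrier) (s : ℕ → M.carrier)
    (t : ℕ → Option K) (τ : L.toLanguage.Term ℕ) :
    (M.expand a).termVal s (((L.toLanguage.lhomWithConstants K).onTerm τ).subst
      fun x => (t x).elim (Language.Term.var x)
        fun i => Language.Constants.term (L.toLanguage.con i)) =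
      M.termVal (fun x => (t x).elim (s x) a) τ := by
  induction τ with
  | var y =>
    simp only [Language.LHom.onTerm, Language.Term.subst, termVal]
    cases t y with
    | none => rfl
    | some i => rfl
  | func f ts ih => exact congrArg (M.funMap f) (funext fun i => ih i)

/-- Trades constants for assignments: conditions can be evaluated in `L`-structures, and `L(C)` is
needed only to read the hypothesis and to state the conclusion. -/
theorem eval_expand_inst {K : Type} (a : K → M.carrier) (φ : PreFormula L.toLanguage) :
    ∀ (s : ℕ → M.carrier) (t : ℕ → Option K),
      (M.expand a).eval (φ.inst t) s = M.eval φ fun x => (t x).elim (s x) a := by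
  induction φ with
  | atom P ts =>
    intro s t
    exact congrArg (M.relMap P) (funext fun i => M.termVal_expand_inst a s t (ts i))
  | neg φ ih => intro s t; exact congrArg unitInterval.symm (ih s t)
  | half φ ih =>
    intro s t
    simp only [eval]
    rw [← ih s t]
    rfl
  | add φ ψ ihφ ihψ =>
    intro s t
    simp only [eval]
    rw [← ihφ s t, ← ihψ s t]
    rfl
  | bigAnd I Φ ih => intro s t; exact iInf_congr fun i => ih i s t
  | inf y φ ih =>
    intro s t
    rw [PreFormula.inst_inf]
    exact iInf_congr fun b => (ih (Function.update s y b) _).trans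
      (congrArg (M.eval φ) (elim_update t s a y b))

theorem eval_expand_lift {K : Type} (a : K → M.carrier) (φ : PreFormula L.toLanguage) :
    ∀ s : ℕ → M.carrier, (M.expand a).eval (φ.lift K) s = M.eval φ s := by
  induction φ with
  | atom P ts =>
    intro s
    refine congrArg (M.relMap P) (funext fun i => ?_)
    change (M.expand a).termVal s ((L.toLanguage.lhomWithConstants K).onTerm (ts i)) = _
    generalize ts i = τ
    induction τ with
    | var y => rfl
    | func f ts ih => exact congrArg (M.funMap f) (funext fun i => ih i)
  | neg φ ih => intro s; exact congrArg unitInterval.symm (ih s)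
  | half φ ih =>
    intro s
    simp only [eval]
    rw [← ih s]
    rfl
  | add φ ψ ihφ ihψ =>
    intro s
    simp only [eval]
    rw [← ihφ s, ← ihψ s]
    rfl
  | bigAnd I Φ ih => intro s; exact iInf_congr fun i => ih i s
  | inf y φ ih => intro s; exact iInf_congr fun b => ih (Function.update s y b)

theorem eval_expand_inclusion {C₀ : Finset ℕ} (a : ℕ → M.carrier)
    (θ : PreFormula (L.addConst C₀).toLanguage) : ∀ s : ℕ → M.carrier,
      (M.expand a).eval θ.inclusion s = (M.expand fun i : C₀ => a i).eval θ s := by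
  have hterm : ∀ (s : ℕ → M.carrier) (τ : (L.addConst C₀).toLanguage.Term ℕ),
      (M.expand a).termVal s
        ((L.toLanguage.lhomWithConstantsMap (Subtype.val : C₀ → ℕ)).onTerm τ) =
      (M.expand fun i : C₀ => a i).termVal s τ := by
    intro s τ
    induction τ with
    | var y => rfl
    | @func n f ts ih =>
      match n, f, ts, ih with
      | _, Sum.inl f, ts, ih => exact congrArg (M.funMap f) (funext fun i => ih i)
      | 0, Sum.inr c, ts, ih => rfl
  induction θ with
  | @atom n P ts =>
    intro s
    match n, P, ts with
    | _, Sum.inl P, ts => exact congrArg (M.relMap P) (funext fun i => hterm s (ts i))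
  | neg φ ih => intro s; exact congrArg unitInterval.symm (ih s)
  | half φ ih =>
    intro s
    simp only [eval]
    rw [← ih s]
    rfl
  | add φ ψ ihφ ihψ =>
    intro s
    simp only [eval]
    rw [← ihφ s, ← ihψ s]
    rfl
  | bigAnd I Φ ih => intro s; exact iInf_congr fun i => ih i s
  | inf y φ ih => intro s; exact iInf_congr fun b => ih (Function.update s y b)

end MetricStructure

/-! ### Conditions -/

/-- The assignment of constants to variables coded by `f`: a modification of the identity at
finitely many places. -/
def asg (f : ℕ →₀ ℕ) (x : ℕ) : ℕ := if f x = 0 then x else f x - 1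

theorem asg_zero : asg 0 = id := by
  funext x
  simp [asg]

/-- The code `0` means that the variable is left alone, so the constant with index `j` is coded by
`j + 1`. -/
theorem asg_update (f : ℕ →₀ ℕ) (x j : ℕ) :
    asg (f.update x (j + 1)) = Function.update (asg f) x j := by
  funext y
  by_cases h : y = x
  · subst h; simp [asg]
  · simp [asg, Function.update_of_ne h]

/-- Finitely supported codes are countable in number, as genericity requires, yet realise every
assignment on finitely many variables. -/
theorem exists_asg_eq (X : Finset ℕ) (t : ℕ → ℕ) : ∃ f, ∀ x ∈ X, asg f x = t x := by
  classical
  refine ⟨Finsupp.onFinset X (fun x => if x ∈ X then t x + 1 else 0) (by simp), fun x hx => ?_⟩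
  simp [asg, hx]

/-- The inequality `φ(c̄) < r`, where the variable `x` is replaced by the constant with index
`asg f x`, is coded as `(φ, f, r)`. -/
abbrev Ineq (L : Signature.{u, v}) := PreFormula L.toLanguage × (ℕ →₀ ℕ) × ℝ

def Ineq.decode (γ : Ineq L) : PreFormula (L.addConst ℕ).toLanguage × ℝ :=
  (γ.1.instConst fun x => some (asg γ.2.1 x), γ.2.2)

def Holds (M : MetricStructure.{u, v, w} L) (a : ℕ → M.carrier) (p : Set (Ineq L)) : Prop :=
  ∀ γ ∈ p, (M.eval γ.1 (a ∘ asg γ.2.1) : ℝ) < γ.2.2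

theorem satisfiable_decode {𝓜 : Set (MetricStructure.{u, v, w} L)} {p : Set (Ineq L)}
    (hp : p.Finite) (hfv : ∀ γ ∈ p, γ.1.freeVars.Finite) {M : MetricStructure.{u, v, w} L}
    (hM : M ∈ 𝓜) {a : ℕ → M.carrier} (h : Holds M a p) :
    Satisfiable 𝓜 (Ineq.decode '' p) := by
  classical
  have hfin : (⋃ γ ∈ p, asg γ.2.1 '' γ.1.freeVars).Finite :=
    hp.biUnion fun γ hγ => (hfv γ hγ).image _
  refine ⟨M, hM, hfin.toFinset, fun i => a i, ?_⟩
  rintro _ ⟨γ, hγ, rfl⟩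
  have hmem : ∀ x ∈ γ.1.freeVars, asg γ.2.1 x ∈ hfin.toFinset := fun x hx => by
    rw [Set.Finite.mem_toFinset]
    exact Set.mem_biUnion hγ ⟨x, hx, rfl⟩
  -- The value `none` never occurs at a free variable of the formula.
  let t : ℕ → Option hfin.toFinset := fun x =>
    if hx : asg γ.2.1 x ∈ hfin.toFinset then some ⟨_, hx⟩ else none
  refine ⟨γ.1.inst t, ?_, ?_, ?_⟩
  · rw [PreFormula.inclusion_inst]
    refine PreFormula.inst_congr _ fun x hx => ?_
    simp only [t, dif_pos (hmem x hx), Option.map_some]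
  · refine Set.eq_empty_of_forall_notMem fun x hx => ?_
    have := PreFormula.freeVars_inst γ.1 t hx
    simp only [t, Set.mem_ofPred_eq] at this
    rw [dif_pos (hmem x this.1)] at this
    exact absurd this.2 (by simp)
  · refine lt_of_eq_of_lt (congrArg Subtype.val ?_) (h γ hγ)
    refine (M.eval_expand_inst _ γ.1 _ t).trans (M.eval_congr _ fun x hx => ?_)
    simp only [t, dif_pos (hmem x hx)]
    rfl

theorem Satisfiable.exists_eval_lt {𝓜 : Set (MetricStructure.{u, v, w} L)}
    {Γ : Set (PreFormula (L.addConst ℕ).toLanguage × ℝ)} (h : Satisfiable 𝓜 Γ) :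
    ∃ M ∈ 𝓜, ∃ a : ℕ → M.carrier, ∀ γ ∈ Γ,
      ((M.expand a).eval γ.1 fun _ => Classical.arbitrary M.carrier : ℝ) < γ.2 := by
  classical
  obtain ⟨M, hM, C₀, a, h⟩ := h
  refine ⟨M, hM, fun i => if hi : i ∈ C₀ then a ⟨i, hi⟩ else Classical.arbitrary _, ?_⟩
  intro γ hγ
  obtain ⟨θ, h1, -, h2⟩ := h γ hγ
  rw [← h1]
  refine lt_of_eq_of_lt (congrArg Subtype.val ?_) h2
  rw [M.eval_expand_inclusion]
  have : (fun i : C₀ => if hi : (i : ℕ) ∈ C₀ then a ⟨i, hi⟩ else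
      Classical.arbitrary M.carrier) = a := by
    funext i
    simp
  rw [this]
  rfl

theorem lookup_zip_map (xs : List ℕ) (t : ℕ → ℕ) {x : ℕ} (hx : x ∈ xs) :
    (xs.zip (xs.map t)).lookup x = some (t x) := by
  induction xs with
  | nil => simp at hx
  | cons y ys ih =>
    simp only [List.map_cons, List.zip_cons_cons, List.lookup_cons]
    by_cases h : x = y
    · subst h; simp
    · have : (x == y) = false := by simpa using h
      rw [this]
      exact ih (by simpa [h] using hx)

/-! ### Prefixes of quantifiers -/

namespace MetricStructure

variable (M : MetricStructure.{u, v, w} L)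

theorem eval_infs_le (ys : List ℕ) (φ : PreFormula L.toLanguage) :
    ∀ s s' : ℕ → M.carrier, (∀ x, x ∉ ys → s' x = s x) →
      M.eval (PreFormula.infs ys φ) s ≤ M.eval φ s' := by
  induction ys with
  | nil =>
    intro s s' h
    rw [show s' = s from funext fun x => h x (by simp)]
    exact le_rfl
  | cons y ys ih =>
    intro s s' h
    refine (iInf_le (fun b => M.eval (PreFormula.infs ys φ) (Function.update s y b))
      (s' y)).trans (ih _ _ fun x hx => ?_)
    by_cases hxy : x = y
    · subst hxy; simp
    · rw [Function.update_of_ne hxy]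
      exact h x (by simp [hxy, hx])

theorem exists_eval_lt_of_infs (ys : List ℕ) (φ : PreFormula L.toLanguage) {r : ℝ} :
    ∀ s : ℕ → M.carrier, (M.eval (PreFormula.infs ys φ) s : ℝ) < r →
      ∃ s' : ℕ → M.carrier, (∀ x, x ∉ ys → s' x = s x) ∧ (M.eval φ s' : ℝ) < r := by
  induction ys with
  | nil => exact fun s h => ⟨s, fun _ _ => rfl, h⟩
  | cons y ys ih =>
    intro s h
    have : ∃ b, (M.eval (PreFormula.infs ys φ) (Function.update s y b) : ℝ) < r := by
      -- Infima are taken in `[0,1]`, so `r` must be placed in that interval before it can serve as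
      -- a lower bound.
      by_contra! hle
      have h0 : 0 ≤ r := (M.eval (PreFormula.infs (y :: ys) φ) s).2.1.trans h.le
      have h1 : r ≤ 1 := (hle (s y)).trans (M.eval _ _).2.2
      have : (⟨r, h0, h1⟩ : unitInterval) ≤ M.eval (PreFormula.infs (y :: ys) φ) s :=
        le_iInf fun b => Subtype.coe_le_coe.1 (hle b)
      exact (not_lt.2 (Subtype.coe_le_coe.2 this)) h
    obtain ⟨b, hb⟩ := this
    obtain ⟨s', h1, h2⟩ := ih _ hb
    refine ⟨s', fun x hx => ?_, h2⟩
    rw [h1 x fun hx' => hx (by simp [hx']), Function.update_of_ne]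
    rintro rfl
    simp at hx

/-- A disjunction is a maximum. The assumption `0 ≤ r` is for the empty disjunction, whose value is
`0`. -/
theorem eval_finOr_le_iff (l : List (PreFormula L.toLanguage)) (s : ℕ → M.carrier) {r : ℝ}
    (hr : 0 ≤ r) : (M.eval (PreFormula.finOr l) s : ℝ) ≤ r ↔ ∀ φ ∈ l, (M.eval φ s : ℝ) ≤ r := by
  have hval : (M.eval (PreFormula.finOr l) s : ℝ) =
      1 - ((⨅ i : {i | i < l.length}, unitInterval.symm (M.eval (l[i.1]'i.2) s) :
        unitInterval) : ℝ) := rfl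
  rw [hval]
  constructor
  · intro h φ hφ
    obtain ⟨i, hi, rfl⟩ := List.getElem_of_mem hφ
    have : ((⨅ i : {i | i < l.length}, unitInterval.symm (M.eval (l[i.1]'i.2) s) :
        unitInterval) : ℝ) ≤ 1 - M.eval l[i] s := Subtype.coe_le_coe.2 (iInf_le
      (fun i : {i | i < l.length} => unitInterval.symm (M.eval (l[i.1]'i.2) s)) ⟨i, hi⟩)
    linarith
  · intro h
    by_cases h1 : 1 ≤ r
    · have := (⨅ i : {i | i < l.length}, unitInterval.symm (M.eval (l[i.1]'i.2) s) :
        unitInterval).2.1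
      linarith
    · have : (⟨1 - r, by linarith, by linarith⟩ : unitInterval) ≤
          ⨅ i : {i | i < l.length}, unitInterval.symm (M.eval (l[i.1]'i.2) s) := by
        refine le_iInf fun i => Subtype.coe_le_coe.1 ?_
        have := h _ (List.getElem_mem i.2)
        rw [unitInterval.coe_symm_eq]
        dsimp only
        linarith
      have : 1 - r ≤ _ := Subtype.coe_le_coe.2 this
      linarith

/-- For each quantifier, the points with value at most `r` form a closed set containing the dense
range of `c`. -/
theorem eval_sups_le (c : ℕ → M.carrier) (hc : DenseRange c) (xs : List ℕ)
    {φ : PreFormula L.toLanguage} (hφ : IsFormula L φ) {r : ℝ}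
    (h : ∀ t : ℕ → ℕ, (M.eval φ (c ∘ t) : ℝ) ≤ r) :
    ∀ t : ℕ → ℕ, (M.eval (PreFormula.sups xs φ) (c ∘ t) : ℝ) ≤ r := by
  induction xs with
  | nil => exact h
  | cons x xs ih =>
    intro t
    have hform : IsFormula L (PreFormula.sups xs φ) := by
      clear ih h
      induction xs with
      | nil => exact hφ
      | cons y ys ih => exact ih
    have hb : ∀ b, (M.eval (PreFormula.sups xs φ) (Function.update (c ∘ t) x b) : ℝ) ≤ r := by
      intro b
      have hcl : IsClosed {b | (M.eval (PreFormula.sups xs φ)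
          (Function.update (c ∘ t) x b) : ℝ) ≤ r} :=
        isClosed_le (continuous_subtype_val.comp (M.continuous_eval_update hform _ _))
          continuous_const
      refine hc.induction_on (p := fun b => (M.eval (PreFormula.sups xs φ)
          (Function.update (c ∘ t) x b) : ℝ) ≤ r) b hcl fun j => ?_
      rw [← Function.comp_update]
      exact ih _
    have hval : (M.eval (PreFormula.sups (x :: xs) φ) (c ∘ t) : ℝ) =
      1 - ((⨅ b, unitInterval.symm (M.eval (PreFormula.sups xs φ)
        (Function.update (c ∘ t) x b)) : unitInterval) : ℝ) := rfl
    rw [hval]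
    have h0 : 0 ≤ r := (M.eval _ _).2.1.trans (ih t)
    by_cases h1 : 1 ≤ r
    · have := (⨅ b, unitInterval.symm (M.eval (PreFormula.sups xs φ)
        (Function.update (c ∘ t) x b)) : unitInterval).2.1
      linarith
    · have : (⟨1 - r, by linarith, by linarith⟩ : unitInterval) ≤
          ⨅ b, unitInterval.symm (M.eval (PreFormula.sups xs φ)
            (Function.update (c ∘ t) x b)) := by
        refine le_iInf fun b => Subtype.coe_le_coe.1 ?_
        have := hb b
        rw [unitInterval.coe_symm_eq]
        dsimp only
        linarith
      have : 1 - r ≤ _ := Subtype.coe_le_coe.2 this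
      linarith

end MetricStructure

/-! ### Completion of a structure on a pseudometric space -/

/-- The modulus condition survives because its premise is open and its conclusion closed in `(a,
b)`, so it need only be checked on the dense image of `D`. -/
theorem exists_extend_completion {n : ℕ} {D E : Type*} [PseudoMetricSpace D] [MetricSpace E]
    [CompleteSpace E] (g : (Fin n → D) → E) (δ : Fin n → ℝ → ℝ≥0∞)
    (hδ : ∀ i ε, 0 < ε → 0 < δ i ε)
    (hg : ∀ i ε, 0 < ε → ∀ a b, ENNReal.ofReal (dist (a i) b) < δ i ε →
      dist (g a) (g (Function.update a i b)) ≤ ε) :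
    ∃ G : (Fin n → Completion D) → E, Continuous G ∧
      (∀ a : Fin n → D, G (fun i => (a i : Completion D)) = g a) ∧
      ∀ i ε, 0 < ε → ∀ a b, ENNReal.ofReal (dist (a i) b) < δ i ε →
        dist (G a) (G (Function.update a i b)) ≤ ε := by
  have hind : IsUniformInducing
      (Pi.map fun _ : Fin n => ((↑) : D → Completion D)) :=
    (Isometry.piMap (fun _ : Fin n => ((↑) : D → Completion D))
      fun _ => Completion.coe_isometry).isUniformInducing
  have hdense : DenseRange (Pi.map fun _ : Fin n => ((↑) : D → Completion D)) :=
    DenseRange.piMap fun _ => Completion.denseRange_coe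
  have hu := uniformContinuous_of_update g δ hδ hg
  set G := (hind.isDenseInducing hdense).extend g
  have hG : Continuous G := (uniformContinuous_uniformly_extend hind hdense hu).continuous
  have hGg : ∀ a : Fin n → D, G (fun i => (a i : Completion D)) = g a :=
    fun a => uniformly_extend_of_ind hind hdense hu a
  refine ⟨G, hG, hGg, fun i ε hε a b hab => ?_⟩
  let e : (Fin n → D) × D → (Fin n → Completion D) × Completion D :=
    Prod.map (Pi.map fun _ => (↑)) (↑)
  have he : DenseRange e := hdense.prodMap Completion.denseRange_coe
  have hopen : IsOpen {z : (Fin n → Completion D) × Completion D |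
      ENNReal.ofReal (dist (z.1 i) z.2) < δ i ε} :=
    isOpen_lt (ENNReal.continuous_ofReal.comp (((continuous_apply i).comp continuous_fst).dist
      continuous_snd)) continuous_const
  have hclosed : IsClosed {z : (Fin n → Completion D) × Completion D |
      dist (G z.1) (G (Function.update z.1 i z.2)) ≤ ε} :=
    isClosed_le ((hG.comp continuous_fst).dist
      (hG.comp (continuous_fst.update i continuous_snd))) continuous_const
  have hmem := he.open_subset_closure_inter hopen (show (a, b) ∈ _ from hab)
  refine hclosed.closure_subset_iff.2 ?_ hmem
  rintro _ ⟨hz, ⟨⟨a, b⟩, rfl⟩⟩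
  have hz : ENNReal.ofReal (dist (a i : Completion D) b) < δ i ε := hz
  rw [Completion.dist_eq] at hz
  have := hg i ε hε a b hz
  rw [← hGg, ← hGg] at this
  refine le_of_eq_of_le (congrArg (fun z => dist (G _) (G z)) ?_) this
  funext j
  by_cases hj : j = i
  · subst hj; simp [e]
  · simp [e, hj]

/-- Data for an `L`-structure on a space that is neither separated nor complete. -/
structure PreStructure (L : Signature.{u, v}) (D : Type w) [PseudoMetricSpace D] where
  funMap : ∀ {n : ℕ}, L.Functions n → (Fin n → D) → D
  relMap : ∀ {n : ℕ}, L.Relations n → (Fin n → D) → unitInterval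
  relMap_d : ∀ a : Fin 2 → D, (relMap L.d a : ℝ) = dist (a 0) (a 1)
  funMap_mod : ∀ {n : ℕ} (f : L.Functions n) (i : Fin n) (ε : ℝ), 0 < ε →
    ∀ (a : Fin n → D) (b : D), ENNReal.ofReal (dist (a i) b) < L.modFun f i ε →
      dist (funMap f a) (funMap f (Function.update a i b)) ≤ ε
  relMap_mod : ∀ {n : ℕ} (P : L.Relations n) (i : Fin n) (ε : ℝ), 0 < ε →
    ∀ (a : Fin n → D) (b : D), ENNReal.ofReal (dist (a i) b) < L.modRel P i ε →
      dist (relMap P a) (relMap P (Function.update a i b)) ≤ ε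

/-- `Completion D` is Hausdorff, so identifying points at distance `0` and completing happen at
once. -/
theorem PreStructure.exists_completion {D : Type w} [PseudoMetricSpace D] [Nonempty D]
    (N : PreStructure L D) :
    ∃ (M : MetricStructure.{u, v, w} L) (ι : D → M.carrier), DenseRange ι ∧
      (∀ a b, dist (ι a) (ι b) = dist a b) ∧
      (∀ {n : ℕ} (f : L.Functions n) (a : Fin n → D),
        M.funMap f (fun i => ι (a i)) = ι (N.funMap f a)) ∧
      ∀ {n : ℕ} (P : L.Relations n) (a : Fin n → D),
        M.relMap P (fun i => ι (a i)) = N.relMap P a := by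
  have hfun := fun (n : ℕ) (f : L.Functions n) => exists_extend_completion
    (fun a => (N.funMap f a : Completion D)) (L.modFun f) (fun i => L.modFun_pos f i)
    (fun i ε hε a b hab => by
      rw [Completion.dist_eq]; exact N.funMap_mod f i ε hε a b hab)
  have hrel := fun (n : ℕ) (P : L.Relations n) => exists_extend_completion
    (N.relMap P) (L.modRel P) (fun i => L.modRel_pos P i) (N.relMap_mod P)
  choose F _ hFN hFmod using hfun
  choose R hRc hRN hRmod using hrel
  have : Nonempty (Completion D) := ⟨((Classical.arbitrary D : D) : Completion D)⟩
  refine ⟨⟨Completion D, fun {n} f => F n f, fun {n} P => R n P, ?_, fun {n} f => hFmod n f,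
    fun {n} P => hRmod n P⟩, (↑), Completion.denseRange_coe, Completion.dist_eq,
    fun {n} f => hFN n f, fun {n} P => hRN n P⟩
  have hdense : DenseRange (Pi.map fun _ : Fin 2 => ((↑) : D → Completion D)) :=
    DenseRange.piMap fun _ => Completion.denseRange_coe
  intro a
  refine hdense.induction_on (p := fun a => (R 2 L.d a : ℝ) = dist (a 0) (a 1)) a
    (isClosed_eq (continuous_subtype_val.comp (hRc 2 L.d))
      ((continuous_apply 0).dist (continuous_apply 1))) fun b => ?_
  refine (congrArg Subtype.val (hRN 2 L.d b)).trans ((N.relMap_d b).trans ?_)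
  exact (Completion.dist_eq _ _).symm

/-! ### Limits along an ultrafilter -/

/-- A structure of the class `𝓜` together with interpretations of all the constants `c_i`. -/
abbrev Interp (𝓜 : Set (MetricStructure.{u, v, w} L)) := Σ M : 𝓜, ℕ → M.1.carrier

variable {𝓜 : Set (MetricStructure.{u, v, w} L)}

def Interp.term (x : Interp 𝓜) (t : L.toLanguage.Term ℕ) : x.1.1.carrier := x.1.1.termVal x.2 t

theorem exists_tendsto_ultrafilter {X Y : Type*} [TopologicalSpace Y] [CompactSpace Y]
    (U : Ultrafilter X) (g : X → Y) : ∃ y, Tendsto g U (𝓝 y) :=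
  ⟨(U.map g).lim, (U.map g).le_nhds_lim⟩

/-- The variable with index `i` plays the role of `c_i`, so `L`-terms serve as closed `L(C)`-terms.
Functions act formally; predicates get their ultralimits in the compact interval `[0,1]`. -/
theorem exists_limit_structure [Small.{w} (L.toLanguage.Term ℕ)] (U : Ultrafilter (Interp 𝓜)) :
    ∃ (M : MetricStructure.{u, v, w} L) (ι : L.toLanguage.Term ℕ → M.carrier), DenseRange ι ∧
      (∀ t t', Tendsto (fun x : Interp 𝓜 => dist (x.term t) (x.term t')) U
        (𝓝 (dist (ι t) (ι t')))) ∧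
      (∀ {n : ℕ} (f : L.Functions n) (ts : Fin n → L.toLanguage.Term ℕ),
        M.funMap f (fun i => ι (ts i)) = ι (.func f ts)) ∧
      ∀ {n : ℕ} (P : L.Relations n) (ts : Fin n → L.toLanguage.Term ℕ),
        Tendsto (fun x : Interp 𝓜 => x.1.1.relMap P fun i => x.term (ts i)) U
          (𝓝 (M.relMap P fun i => ι (ts i))) := by
  have hlim := fun (n : ℕ) (P : L.Relations n) (ts : Fin n → L.toLanguage.Term ℕ) =>
    exists_tendsto_ultrafilter U fun x : Interp 𝓜 => x.1.1.relMap P fun i => x.term (ts i)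
  choose R hR using hlim
  have hd : ∀ t t', Tendsto (fun x : Interp 𝓜 => dist (x.term t) (x.term t')) U
      (𝓝 (R 2 L.d ![t, t'] : ℝ)) := fun t t' =>
    ((continuous_subtype_val.tendsto _).comp (hR 2 L.d ![t, t'])).congr fun x => x.1.1.relMap_d _
  -- Moves the terms into the universe `w` required of the carrier.
  let e := equivShrink.{w} (L.toLanguage.Term ℕ)
  let _ : PseudoMetricSpace (Shrink.{w} (L.toLanguage.Term ℕ)) :=
    { dist := fun a b => R 2 L.d ![e.symm a, e.symm b]
      dist_self := fun a => tendsto_nhds_unique (hd _ _) (by simp)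
      dist_comm := fun a b => tendsto_nhds_unique (hd _ _)
        ((hd _ _).congr fun x => dist_comm _ _)
      dist_triangle := fun a b c => le_of_tendsto_of_tendsto' (hd _ _) ((hd _ _).add (hd _ _))
        fun x => dist_triangle _ _ _ }
  have hd' : ∀ a b : Shrink.{w} (L.toLanguage.Term ℕ), Tendsto
      (fun x : Interp 𝓜 => dist (x.term (e.symm a)) (x.term (e.symm b))) U
      (𝓝 (dist a b)) := fun a b => hd _ _
  have hupd : ∀ {n : ℕ} (x : Interp 𝓜) (a : Fin n → Shrink.{w} (L.toLanguage.Term ℕ)) i b,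
      (fun j => x.term (e.symm (Function.update a i b j))) =
        Function.update (fun j => x.term (e.symm (a j))) i (x.term (e.symm b)) := by
    intro n x a i b
    funext j
    by_cases hj : j = i
    · subst hj; simp
    · simp [hj]
  let N : PreStructure L (Shrink.{w} (L.toLanguage.Term ℕ)) :=
    { funMap := fun f a => e (.func f fun i => e.symm (a i))
      relMap := fun {n} P a => R n P fun i => e.symm (a i)
      relMap_d := fun a => congrArg (fun ts => (R 2 L.d ts : ℝ)) <| funext fun i => by
        fin_cases i <;> rfl
      funMap_mod := fun {n} f i ε hε a b hab => by
        refine le_of_tendsto (hd' _ _) ?_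
        -- A strict inequality for the limit distance holds almost everywhere, and the resulting `≤`
        -- passes back to the limit.
        have := ((ENNReal.continuous_ofReal.tendsto _).comp (hd' (a i) b)).eventually_lt_const hab
        filter_upwards [this] with x hx
        rw [Equiv.symm_apply_apply, Equiv.symm_apply_apply]
        have := x.1.1.funMap_mod f i ε hε (fun j => x.term (e.symm (a j))) (x.term (e.symm b)) hx
        rw [← hupd] at this
        exact this
      relMap_mod := fun {n} P i ε hε a b hab => by
        refine le_of_tendsto ((hR n P _).dist (hR n P _)) ?_
        have := ((ENNReal.continuous_ofReal.tendsto _).comp (hd' (a i) b)).eventually_lt_const hab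
        filter_upwards [this] with x hx
        have := x.1.1.relMap_mod P i ε hε (fun j => x.term (e.symm (a j))) (x.term (e.symm b)) hx
        rw [← hupd] at this
        exact this }
  have : Nonempty (Shrink.{w} (L.toLanguage.Term ℕ)) := ⟨e (.var 0)⟩
  obtain ⟨M, ι, hι, hdist, hfun, hrel⟩ := N.exists_completion
  refine ⟨M, ι ∘ e, hι.comp e.surjective.denseRange (continuous_iff_continuousAt.2 fun a => ?_),
    fun t t' => ?_, fun {n} f ts => ?_, fun {n} P ts => ?_⟩
  · exact ((Isometry.of_dist_eq hdist).continuous).continuousAt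
  · have := hd' (e t) (e t')
    rw [Equiv.symm_apply_apply, Equiv.symm_apply_apply] at this
    rw [Function.comp, Function.comp, hdist]
    exact this
  · refine (hfun f fun i => e (ts i)).trans ?_
    simp [N]
  · have := hR n P ts
    have h2 := hrel P fun i => e (ts i)
    simp only [N, Equiv.symm_apply_apply] at h2
    rw [← h2] at this
    exact this

/-! ### Values of formulas in the limit structure -/

theorem Interp.term_relabel (x : Interp 𝓜) (s : ℕ → ℕ) (t : L.toLanguage.Term ℕ) :
    x.term (t.relabel s) = x.1.1.termVal (x.2 ∘ s) t := by
  induction t with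
  | var y => rfl
  | func f ts ih => exact congrArg (x.1.1.funMap f) (funext fun i => ih i)

theorem termVal_eq_relabel {M : MetricStructure.{u, v, w} L} {ι : L.toLanguage.Term ℕ → M.carrier}
    (hfun : ∀ {n : ℕ} (f : L.Functions n) (ts : Fin n → L.toLanguage.Term ℕ),
        M.funMap f (fun i => ι (ts i)) = ι (.func f ts)) (s : ℕ → ℕ) (t : L.toLanguage.Term ℕ) :
    M.termVal (fun x => ι (.var (s x))) t = ι (t.relabel s) := by
  induction t with
  | var y => rfl
  | func f ts ih =>
    exact (congrArg (M.funMap f) (funext fun i => ih i)).trans (hfun f _)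

/-- The ultrafilter has witnesses among the constants for the formulas in `S`. -/
structure IsHenkin (S : Set (PreFormula L.toLanguage)) (U : Ultrafilter (Interp 𝓜)) : Prop where
  term : ∀ (t : L.toLanguage.Term ℕ) (q : ℚ), 0 < q →
    ∃ j, ∀ᶠ x in (U : Filter (Interp 𝓜)), dist (x.term t) (x.2 j) < q
  bigAnd : ∀ I Φ, PreFormula.bigAnd I Φ ∈ S → ∀ (f : ℕ →₀ ℕ) (q : ℚ), q ≤ 1 →
    (∀ᶠ x in (U : Filter (Interp 𝓜)),
      (x.1.1.eval (.bigAnd I Φ) (x.2 ∘ asg f) : ℝ) < q) →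
    ∃ i, ∀ᶠ x in (U : Filter (Interp 𝓜)), (x.1.1.eval (Φ i) (x.2 ∘ asg f) : ℝ) < q
  inf : ∀ y φ, PreFormula.inf y φ ∈ S → ∀ (f : ℕ →₀ ℕ) (q : ℚ),
    (∀ᶠ x in (U : Filter (Interp 𝓜)),
      (x.1.1.eval (.inf y φ) (x.2 ∘ asg f) : ℝ) < q) →
    ∃ j, ∀ᶠ x in (U : Filter (Interp 𝓜)),
      (x.1.1.eval φ (x.2 ∘ asg (f.update y (j + 1))) : ℝ) < q

theorem PreFormula.self_mem_sub (φ : PreFormula L.toLanguage) : φ ∈ φ.sub := by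
  cases φ <;> simp [PreFormula.sub]

/-- A Łoś theorem by induction on formulas. Connectives are continuous; for infima one inequality is
monotonicity of limits and the other comes from the witnesses in `IsHenkin`. -/
theorem exists_canonical_limit [Small.{w} (L.toLanguage.Term ℕ)]
    {A S : Set (PreFormula L.toLanguage)} (hA : IsFragment L A) (hS : IsSubclass L A S)
    {U : Ultrafilter (Interp 𝓜)} (hU : IsHenkin S U) :
    ∃ (M : MetricStructure.{u, v, w} L) (c : ℕ → M.carrier), DenseRange c ∧
      ∀ φ ∈ S, ∀ f : ℕ →₀ ℕ, Tendsto (fun x : Interp 𝓜 => x.1.1.eval φ (x.2 ∘ asg f)) U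
        (𝓝 (M.eval φ (c ∘ asg f))) := by
  obtain ⟨M, ι, hι, hdist, hfun, hrel⟩ := exists_limit_structure U
  have hdense : DenseRange fun j => ι (.var j) := by
    have hsub : Set.range ι ⊆ closure (Set.range fun j => ι (.var j)) := by
      rintro _ ⟨t, rfl⟩
      refine Metric.mem_closure_iff.2 fun ε hε => ?_
      obtain ⟨q, hq0, hq⟩ := exists_rat_btwn hε
      obtain ⟨j, hj⟩ := hU.term t q (by exact_mod_cast hq0)
      refine ⟨_, ⟨j, rfl⟩, lt_of_le_of_lt (le_of_tendsto (hdist _ _) ?_) hq⟩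
      filter_upwards [hj] with x hx using hx.le
    intro b
    exact closure_minimal hsub isClosed_closure (hι b)
  refine ⟨M, fun j => ι (.var j), hdense, ?_⟩
  have hsub : ∀ {φ ψ}, φ ∈ S → ψ ∈ φ.sub → ψ ∈ S := fun h h' => hS.sub_subset _ h h'
  intro φ
  induction φ with
  | atom P ts =>
    intro _ f
    simp only [MetricStructure.eval, Function.comp_def, termVal_eq_relabel hfun]
    refine (hrel P _).congr fun x => ?_
    simp only [x.term_relabel]
    rfl
  | neg φ ih =>
    intro h f
    exact (unitInterval.continuous_symm.tendsto _).comp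
      (ih (hsub h (Or.inr φ.self_mem_sub)) f)
  | half φ ih =>
    intro h f
    have := ih (hsub h (Or.inr φ.self_mem_sub)) f
    exact (continuous_projIcc.tendsto _).comp
      (((continuous_subtype_val.tendsto _).comp this).div_const 2)
  | add φ ψ ihφ ihψ =>
    intro h f
    have h1 := ihφ (hsub h (Or.inl (Or.inr φ.self_mem_sub))) f
    have h2 := ihψ (hsub h (Or.inr ψ.self_mem_sub)) f
    exact (continuous_projIcc.tendsto _).comp
      (((continuous_subtype_val.tendsto _).comp h1).add
        ((continuous_subtype_val.tendsto _).comp h2))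
  | bigAnd I Φ ih =>
    intro h f
    have ih := fun i => ih i (hsub h (Or.inr (Set.mem_iUnion.2 ⟨i, (Φ i).self_mem_sub⟩))) f
    obtain ⟨l, hl⟩ := exists_tendsto_ultrafilter U
      fun x : Interp 𝓜 => x.1.1.eval (.bigAnd I Φ) (x.2 ∘ asg f)
    suffices hle : M.eval (.bigAnd I Φ) ((fun j => ι (.var j)) ∘ asg f) = l by rwa [hle]
    -- Were the limit `l` smaller, a rational `q` in between would provide a conjunct whose limit
    -- value is at most `q`.
    refine le_antisymm (le_of_not_gt fun hlt => ?_) (le_iInf fun i =>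
      le_of_tendsto_of_tendsto' hl (ih i) fun x => iInf_le _ i)
    obtain ⟨q, hlq, hq⟩ := exists_rat_btwn (Subtype.coe_lt_coe.2 hlt)
    obtain ⟨i, hi⟩ := hU.bigAnd I Φ h f q
      (by exact_mod_cast hq.le.trans (Subtype.prop (M.eval _ _)).2)
      (((continuous_subtype_val.tendsto _).comp hl).eventually_lt_const hlq)
    have h1 := le_of_tendsto ((continuous_subtype_val.tendsto _).comp (ih i))
      (hi.mono fun x hx => hx.le)
    have h2 : M.eval (.bigAnd I Φ) ((fun j => ι (.var j)) ∘ asg f) ≤ M.eval (Φ i) _ :=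
      iInf_le _ i
    exact absurd (hq.trans_le (Subtype.coe_le_coe.2 h2)) (not_lt.2 h1)
  | inf y φ ih =>
    intro h f
    have ih := ih (hsub h (Or.inr φ.self_mem_sub))
    obtain ⟨l, hl⟩ := exists_tendsto_ultrafilter U
      fun x : Interp 𝓜 => x.1.1.eval (.inf y φ) (x.2 ∘ asg f)
    suffices hle : M.eval (.inf y φ) ((fun j => ι (.var j)) ∘ asg f) = l by rwa [hle]
    have hcomp : ∀ {α : Type w} (g : ℕ → α) j,
        g ∘ asg (f.update y (j + 1)) = Function.update (g ∘ asg f) y (g j) := by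
      intro α g j
      rw [asg_update, Function.comp_update]
    refine le_antisymm (le_of_not_gt fun hlt => ?_) (le_iInf fun b => ?_)
    · obtain ⟨q, hlq, hq⟩ := exists_rat_btwn (Subtype.coe_lt_coe.2 hlt)
      obtain ⟨j, hj⟩ := hU.inf y φ h f q
        (((continuous_subtype_val.tendsto _).comp hl).eventually_lt_const hlq)
      have h1 := le_of_tendsto ((continuous_subtype_val.tendsto _).comp
        (ih (f.update y (j + 1)))) (hj.mono fun x hx => hx.le)
      have h2 : M.eval (.inf y φ) ((fun j => ι (.var j)) ∘ asg f) ≤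
          M.eval φ ((fun j => ι (.var j)) ∘ asg (f.update y (j + 1))) := by
        rw [hcomp]
        exact iInf_le (fun b => M.eval φ (Function.update _ y b)) _
      exact absurd (hq.trans_le (Subtype.coe_le_coe.2 h2)) (not_lt.2 h1)
    · have hform : IsFormula L (.inf y φ) := hA.isFormula _ (hS.subset h)
      -- By continuity the lower bound `l` need only be checked at constants.
      refine hdense.induction_on (p := fun b => l ≤ M.eval φ
        (Function.update ((fun j => ι (.var j)) ∘ asg f) y b)) b
        (isClosed_le continuous_const (M.continuous_eval_update (φ := φ) hform _ y)) fun j => ?_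
      rw [← hcomp (fun j => ι (.var j))]
      refine le_of_tendsto_of_tendsto' hl (ih _) fun x => ?_
      rw [hcomp]
      exact iInf_le (fun b => x.1.1.eval φ (Function.update _ y b)) _

/-! ### Generic sets of conditions -/

/-- The Rasiowa–Sikorski lemma; stronger conditions are larger, so dense means cofinal. -/
theorem exists_generic {P ι : Type*} [Preorder P] [Countable ι] (p₀ : P) (D : ι → Set P)
    (hD : ∀ i, IsCofinal (D i)) :
    ∃ G : Set P, G.Nonempty ∧ DirectedOn (· ≤ ·) G ∧ ∀ i, ∃ p ∈ D i, p ∈ G := by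
  have := Encodable.ofCountable ι
  let 𝒟 : ι → Order.Cofinal P := fun i => ⟨D i, hD i⟩
  exact ⟨Order.idealOfCofinals p₀ 𝒟, (Order.idealOfCofinals p₀ 𝒟).nonempty,
    (Order.idealOfCofinals p₀ 𝒟).directed, Order.cofinal_meets_idealOfCofinals p₀ 𝒟⟩

/-- The conditions: finite satisfiable sets of inequalities. -/
def Cond (S : Set (PreFormula L.toLanguage)) (𝓜 : Set (MetricStructure.{u, v, w} L)) :=
  {p : Set (Ineq L) // p.Finite ∧ (∀ γ ∈ p, γ.1 ∈ S) ∧ ∃ x : Interp 𝓜, Holds x.1.1 x.2 p}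

variable {S : Set (PreFormula L.toLanguage)} {𝓜 : Set (MetricStructure.{u, v, w} L)}

instance : Preorder (Cond S 𝓜) := inferInstanceAs (Preorder (Subtype _))

theorem nonempty_cond (S : Set (PreFormula L.toLanguage)) (h𝓜 : 𝓜.Nonempty) :
    Nonempty (Cond S 𝓜) := by
  obtain ⟨M, hM⟩ := h𝓜
  exact ⟨∅, Set.finite_empty, by simp, ⟨⟨M, hM⟩, fun _ => Classical.arbitrary _⟩, by simp [Holds]⟩

theorem Holds.mono {M : MetricStructure.{u, v, w} L} {a : ℕ → M.carrier} {p q : Set (Ineq L)}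
    (hpq : p ⊆ q) (h : Holds M a q) : Holds M a p := fun γ hγ => h γ (hpq hγ)

theorem exists_ultrafilter_of_directed {G : Set (Cond S 𝓜)} (hG : G.Nonempty)
    (hdir : DirectedOn (· ≤ ·) G) :
    ∃ U : Ultrafilter (Interp 𝓜), ∀ p ∈ G, ∀ᶠ x in (U : Filter (Interp 𝓜)),
      Holds x.1.1 x.2 p.1 := by
  have : Nonempty G := hG.to_subtype
  have hne : NeBot (⨅ p : G, 𝓟 {x : Interp 𝓜 | Holds x.1.1 x.2 p.1.1}) := by
    refine iInf_neBot_of_directed' (fun p q => ?_) fun p => ?_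
    · obtain ⟨r, hr, hpr, hqr⟩ := hdir p.1 p.2 q.1 q.2
      exact ⟨⟨r, hr⟩, principal_mono.2 fun x hx => hx.mono hpr,
        principal_mono.2 fun x hx => hx.mono hqr⟩
    · obtain ⟨x, hx⟩ := p.1.2.2.2
      exact principal_neBot_iff.2 ⟨x, hx⟩
  refine ⟨Ultrafilter.of (⨅ p : G, 𝓟 {x : Interp 𝓜 | Holds x.1.1 x.2 p.1.1}), fun p hp => ?_⟩
  have h1 := (Ultrafilter.of_le (⨅ p : G, 𝓟 {x : Interp 𝓜 | Holds x.1.1 x.2 p.1.1})).trans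
    (iInf_le _ ⟨p, hp⟩)
  exact le_principal_iff.1 h1

/-- Constants with index at least `N` do not occur in `p` or in `Y`, so reinterpreting them does no
harm. -/
theorem exists_fresh {p : Set (Ineq L)} (hp : p.Finite) (hfv : ∀ γ ∈ p, γ.1.freeVars.Finite)
    (Y : Finset ℕ) : ∃ N, (∀ y ∈ Y, y < N) ∧ ∀ (M : MetricStructure.{u, v, w} L)
      (a a' : ℕ → M.carrier), (∀ m < N, a' m = a m) → Holds M a p → Holds M a' p := by
  have hfin : (⋃ γ ∈ p, asg γ.2.1 '' γ.1.freeVars).Finite :=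
    hp.biUnion fun γ hγ => (hfv γ hγ).image _
  obtain ⟨N, hN⟩ := (hfin.union Y.finite_toSet).bddAbove
  refine ⟨N + 1, fun y hy => Nat.lt_succ_of_le (hN (Or.inr hy)), fun M a a' haa h γ hγ => ?_⟩
  have := h γ hγ
  rwa [M.eval_congr γ.1 (s' := a ∘ asg γ.2.1)]
  intro x hx
  exact haa _ (Nat.lt_succ_of_le (hN (Or.inl (Set.mem_biUnion hγ ⟨x, hx, rfl⟩))))

/-- Extension of a condition by finitely many inequalities that hold at the same place. -/
def Cond.union (p : Cond S 𝓜) (q : Set (Ineq L)) (hq : q.Finite) (hqS : ∀ γ ∈ q, γ.1 ∈ S)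
    (x : Interp 𝓜) (hx : Holds x.1.1 x.2 p.1) (hxq : Holds x.1.1 x.2 q) : Cond S 𝓜 :=
  ⟨p.1 ∪ q, p.2.1.union hq, fun γ hγ => hγ.elim (p.2.2.1 γ) (hqS γ),
    x, fun γ hγ => hγ.elim (hx γ) (hxq γ)⟩

variable {A : Set (PreFormula L.toLanguage)}

/-- `p` decides that the formula `φ` has value at least `q`, or contains a witness for the
opposite. -/
def Witnesses (φ : PreFormula L.toLanguage) (f : ℕ →₀ ℕ) (q : ℚ) (p : Cond S 𝓜) : Prop :=
  (∀ x : Interp 𝓜, Holds x.1.1 x.2 p.1 → (q : ℝ) ≤ x.1.1.eval φ (x.2 ∘ asg f)) ∨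
    match φ with
    | .bigAnd _ Φ => 1 < q ∨ ∃ i, (Φ i, f, (q : ℝ)) ∈ p.1
    | .inf y φ => ∃ j, (φ, f.update y (j + 1), (q : ℝ)) ∈ p.1
    | _ => True

/-- If `p` does not force the value up to `q`, some place satisfying `p` has a smaller value. A
conjunct or point witnessing this there, the point named by a fresh constant, extends `p`. -/
theorem isCofinal_witnesses (hA : IsFragment L A) (hS : IsSubclass L A S)
    {φ : PreFormula L.toLanguage} (hφ : φ ∈ S) (f : ℕ →₀ ℕ) (q : ℚ) :
    IsCofinal {p : Cond S 𝓜 | Witnesses φ f q p} := by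
  intro p
  by_cases hdec : ∀ x : Interp 𝓜, Holds x.1.1 x.2 p.1 → (q : ℝ) ≤ x.1.1.eval φ (x.2 ∘ asg f)
  · exact ⟨p, Or.inl hdec, le_rfl⟩
  push Not at hdec
  obtain ⟨x, hxp, hx⟩ := hdec
  have hfv : ∀ ψ ∈ S, ψ.freeVars.Finite := fun ψ hψ =>
    (hA.isFormula _ (hS.subset hψ)).finite_freeVars
  cases φ with
  | bigAnd I Φ =>
    -- Above `1` there may be no witness: an empty conjunction has value `1`.
    by_cases hq : 1 < q
    · exact ⟨p, Or.inr (Or.inl hq), le_rfl⟩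
    have h0 : (0 : ℝ) ≤ q := (Subtype.prop (x.1.1.eval _ _)).1.trans hx.le
    have h1 : (q : ℝ) ≤ 1 := by exact_mod_cast not_lt.1 hq
    have hlt : x.1.1.eval (.bigAnd I Φ) (x.2 ∘ asg f) < (⟨q, h0, h1⟩ : unitInterval) := hx
    obtain ⟨i, hi⟩ := iInf_lt_iff.1 hlt
    have hmem : Φ i ∈ S :=
      hS.sub_subset _ hφ (Or.inr (Set.mem_iUnion.2 ⟨i, (Φ i).self_mem_sub⟩))
    refine ⟨p.union {(Φ i, f, (q : ℝ))} (Set.finite_singleton _) ?_ x hxp ?_,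
      Or.inr (Or.inr ⟨i, Or.inr rfl⟩), Set.subset_union_left⟩
    · rintro _ rfl; exact hmem
    · rintro _ rfl; exact hi
  | inf y φ =>
    have hmem : φ ∈ S := hS.sub_subset _ hφ (Or.inr φ.self_mem_sub)
    obtain ⟨s, hs, hlt⟩ := x.1.1.exists_eval_lt_of_infs [y] φ (x.2 ∘ asg f) hx
    -- The new constant must also avoid those that `f` puts into `φ`.
    obtain ⟨N, hN, hfresh⟩ := exists_fresh.{u, v, w} p.2.1 (fun γ hγ => hfv _ (p.2.2.1 γ hγ))
      ((hfv φ hmem).toFinset.image (asg f))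
    let a' := Function.update x.2 N (s y)
    refine ⟨p.union {(φ, f.update y (N + 1), (q : ℝ))} (Set.finite_singleton _) ?_ ⟨x.1, a'⟩
      (hfresh _ x.2 a' (fun m hm => Function.update_of_ne hm.ne _ _) hxp) ?_,
      Or.inr ⟨N, Or.inr rfl⟩, Set.subset_union_left⟩
    · rintro _ rfl; exact hmem
    · rintro _ rfl
      refine lt_of_eq_of_lt (congrArg Subtype.val (x.1.1.eval_congr φ fun z hz => ?_)) hlt
      simp only [Function.comp, asg_update]
      by_cases hzy : z = y
      · subst hzy
        simp [a']
      · have hne : asg f z ≠ N :=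
          (hN _ (Finset.mem_image_of_mem _ ((hfv φ hmem).mem_toFinset.2 hz))).ne
        rw [Function.update_of_ne hzy, hs z (by simpa using hzy)]
        exact Function.update_of_ne hne _ _
  | atom P ts => exact ⟨p, Or.inr trivial, le_rfl⟩
  | neg φ => exact ⟨p, Or.inr trivial, le_rfl⟩
  | half φ => exact ⟨p, Or.inr trivial, le_rfl⟩
  | add φ ψ => exact ⟨p, Or.inr trivial, le_rfl⟩

/-- A fresh constant is interpreted as the value of `t`, so the distance is `0`. The code `0` is the
identity assignment, which makes variable `N` stand for `c_N`. -/
theorem isCofinal_term (hA : IsFragment L A) (hS : IsSubclass L A S)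
    (t : L.toLanguage.Term ℕ) {q : ℚ} (hq : 0 < q) :
    IsCofinal {p : Cond S 𝓜 | ∃ j, (PreFormula.atom L.d ![t, .var j], 0, (q : ℝ)) ∈ p.1} := by
  intro p
  obtain ⟨x, hxp⟩ := p.2.2.2
  obtain ⟨N, hN, hfresh⟩ := exists_fresh.{u, v, w} p.2.1
    (fun γ hγ => (hA.isFormula _ (hS.subset (p.2.2.1 γ hγ))).finite_freeVars) t.varFinset
  let a' := Function.update x.2 N (x.term t)
  refine ⟨p.union {(PreFormula.atom L.d ![t, .var N], 0, (q : ℝ))} (Set.finite_singleton _) ?_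
    ⟨x.1, a'⟩ (hfresh _ x.2 a' (fun m hm => Function.update_of_ne hm.ne _ _) hxp) ?_,
    ⟨N, Or.inr rfl⟩, Set.subset_union_left⟩
  · rintro _ rfl; exact hS.atom_mem _ _
  · rintro _ rfl
    have hd := x.1.1.relMap_d fun i => x.1.1.termVal a' (![t, .var N] i)
    refine lt_of_eq_of_lt ?_ (Rat.cast_pos.2 hq)
    simp only [asg_zero, Function.comp_id, MetricStructure.eval]
    refine hd.trans ?_
    have h1 : x.1.1.termVal a' t = x.term t :=
      x.1.1.termVal_congr t fun z hz => Function.update_of_ne (hN z hz).ne _ _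
    have h2 : x.1.1.termVal a' (.var N) = x.term t := Function.update_self _ _ _
    simp [h1, h2]

/-! ### The forced formulas -/

theorem PreFormula.freeVars_infs (ys : List ℕ) (φ : PreFormula L.toLanguage) :
    (PreFormula.infs ys φ).freeVars = {x | x ∈ φ.freeVars ∧ x ∉ ys} := by
  induction ys with
  | nil => simp [PreFormula.infs]
  | cons y ys ih =>
    change (PreFormula.infs ys φ).freeVars \ {y} = _
    rw [ih]
    ext x
    simp only [Set.mem_sdiff, Set.mem_ofPred_eq, Set.mem_singleton_iff, List.mem_cons]
    tauto

theorem PreFormula.mem_freeVars_finOr {l : List (PreFormula L.toLanguage)} {x : ℕ}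
    (hx : x ∈ (PreFormula.finOr l).freeVars) : ∃ φ ∈ l, x ∈ φ.freeVars := by
  obtain ⟨i, hi⟩ := Set.mem_iUnion.1 (show x ∈ ⋃ i : {i | i < l.length}, (l[i.1]'i.2).freeVars
    from hx)
  exact ⟨_, List.getElem_mem _, hi⟩

theorem SupAndInf.freeVars_finOr (F : SupAndInf L A S) (k : ℕ) {x : ℕ}
    (hx : x ∈ (PreFormula.finOr (F.σ k)).freeVars) : x ∈ F.xs ∨ x ∈ F.ys k := by
  obtain ⟨φ, hφ, hx⟩ := PreFormula.mem_freeVars_finOr hx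
  exact List.mem_append.1 (F.σ_freeVars k φ hφ x hx)

theorem SupAndInf.freeVars_psi (F : SupAndInf L A S) {x : ℕ} (hx : x ∈ F.psi.freeVars) :
    x ∈ F.xs := by
  obtain ⟨k, hk⟩ := Set.mem_iUnion.1 hx
  rw [PreFormula.freeVars_infs] at hk
  exact (F.freeVars_finOr k.1 hk.1).resolve_right hk.2

/-- The hypothesis of the omitting types theorem for a single formula. -/
def SatWithPieces (𝓜 : Set (MetricStructure.{u, v, w} L)) (F : SupAndInf L A S) (r : ℝ) : Prop :=
  ∀ p : Set (PreFormula (L.addConst ℕ).toLanguage × ℝ), IsPiece S 𝓜 p →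
    ∀ cs : List ℕ, cs.length = F.xs.length →
      Satisfiable 𝓜 (p ∪ {(F.psi.atConsts F.xs cs, r)})

/-- Turns the satisfiability hypothesis into a place where `p` and `ψ(c̄) < r` hold together; `c̄`
is the tuple that `asg f` assigns to `F.xs`. -/
theorem SatWithPieces.exists_interp (hA : IsFragment L A) (hS : IsSubclass L A S)
    {F : SupAndInf L A S} {r : ℝ} (h : SatWithPieces 𝓜 F r) (p : Cond S 𝓜) (f : ℕ →₀ ℕ) :
    ∃ x : Interp 𝓜, Holds x.1.1 x.2 p.1 ∧ (x.1.1.eval F.psi (x.2 ∘ asg f) : ℝ) < r := by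
  have hfv : ∀ γ ∈ p.1, γ.1.freeVars.Finite := fun γ hγ =>
    (hA.isFormula _ (hS.subset (p.2.2.1 γ hγ))).finite_freeVars
  have hpiece : IsPiece S 𝓜 (Ineq.decode '' p.1) := by
    obtain ⟨x, hx⟩ := p.2.2.2
    refine ⟨p.2.1.image _, ?_, satisfiable_decode p.2.1 hfv x.1.2 hx⟩
    rintro _ ⟨γ, hγ, rfl⟩
    refine ⟨⟨γ.1, p.2.2.1 γ hγ, _, rfl⟩, Set.eq_empty_of_forall_notMem fun x hx => ?_⟩
    exact absurd (PreFormula.freeVars_inst γ.1 _ hx).2 (by simp)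
  obtain ⟨M, hM, a, ha⟩ := (h _ hpiece (F.xs.map (asg f)) (by simp)).exists_eval_lt
  refine ⟨⟨⟨M, hM⟩, a⟩, fun γ hγ => ?_, ?_⟩
  · have hγ' := ha _ (Or.inl ⟨γ, hγ, rfl⟩)
    exact lt_of_eq_of_lt (congrArg Subtype.val (M.eval_expand_inst a γ.1 _
      fun x => some (asg γ.2.1 x)).symm) hγ'
  · refine lt_of_eq_of_lt (congrArg Subtype.val ?_) (ha _ (Or.inr rfl))
    refine Eq.trans ?_ (M.eval_expand_inst a F.psi _ _).symm
    refine M.eval_congr _ fun x hx => ?_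
    rw [lookup_zip_map _ _ (F.freeVars_psi hx)]
    rfl

/-- Values are nonnegative and `ψ(c̄) < r` is satisfiable. The bound is needed for empty
disjunctions. -/
theorem SatWithPieces.nonneg (hA : IsFragment L A) (hS : IsSubclass L A S) (h𝓜 : 𝓜.Nonempty)
    {F : SupAndInf L A S} {r : ℝ} (h : SatWithPieces 𝓜 F r) : 0 ≤ r := by
  obtain ⟨p⟩ := nonempty_cond S h𝓜
  obtain ⟨x, -, hx⟩ := h.exists_interp hA hS p 0
  exact (x.1.1.eval F.psi _).2.1.trans hx.le

/-- At a place where `ψ(c̄) < r`, some conjunct is below `r`, and points `ȳ` bring its disjunction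
below `r`. A disjunction being a maximum, all disjuncts are below `r` there; naming `ȳ` by fresh
constants gives the extension. -/
theorem isCofinal_forced (hA : IsFragment L A) (hS : IsSubclass L A S)
    {F : SupAndInf L A S} {r : ℝ} (h : SatWithPieces 𝓜 F r) (f : ℕ →₀ ℕ) :
    IsCofinal {p : Cond S 𝓜 | ∃ (f' : ℕ →₀ ℕ) (k : ℕ), (∀ x ∈ F.xs, asg f' x = asg f x) ∧
      ∀ φ ∈ F.σ k, (φ, f', r) ∈ p.1} := by
  classical
  intro p
  obtain ⟨x, hxp, hx⟩ := h.exists_interp hA hS p f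
  have hk : ∃ k, (x.1.1.eval (PreFormula.infs (F.ys k) (PreFormula.finOr (F.σ k)))
      (x.2 ∘ asg f) : ℝ) < r := by
    by_contra! hle
    have h0 : 0 ≤ r := (x.1.1.eval F.psi _).2.1.trans hx.le
    have h1 : r ≤ 1 := (hle 0).trans (x.1.1.eval _ _).2.2
    have : (⟨r, h0, h1⟩ : unitInterval) ≤ x.1.1.eval F.psi (x.2 ∘ asg f) :=
      le_iInf fun k => Subtype.coe_le_coe.1 (hle k.1)
    exact not_lt.2 (Subtype.coe_le_coe.2 this) hx
  obtain ⟨k, hk⟩ := hk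
  obtain ⟨s, hs, hlt⟩ := x.1.1.exists_eval_lt_of_infs _ _ _ hk
  -- An intermediate `r'` keeps the inequality strict through `eval_finOr_le_iff`, which speaks of
  -- `≤`.
  obtain ⟨r', hr', hr'r⟩ := exists_between hlt
  have hle := (x.1.1.eval_finOr_le_iff (F.σ k) s
    ((x.1.1.eval _ s).2.1.trans hr'.le)).1 hr'.le
  obtain ⟨N, hN, hfresh⟩ := exists_fresh.{u, v, w} p.2.1
    (fun γ hγ => (hA.isFormula _ (hS.subset (p.2.2.1 γ hγ))).finite_freeVars)
    (F.xs.toFinset.image (asg f))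
  -- The constant with index `N + z` names the witness `s z`; constants below `N` keep their
  -- meaning.
  let a' : ℕ → x.1.1.carrier := fun m => if m < N then x.2 m else s (m - N)
  obtain ⟨f', hf'⟩ := exists_asg_eq (F.xs ++ F.ys k).toFinset
    fun z => if z ∈ F.ys k then N + z else asg f z
  have hdisj : ∀ z ∈ F.xs, z ∉ F.ys k := fun z hz hz' =>
    (List.nodup_append.1 (F.nodup k)).2.2 z hz z hz' rfl
  have hmem : ∀ φ ∈ F.σ k, φ ∈ S := F.σ_mem k
  refine ⟨p.union ((fun φ => (φ, f', r)) '' {φ | φ ∈ F.σ k}) ((List.finite_toSet _).image _) ?_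
    ⟨x.1, a'⟩ (hfresh _ x.2 a' (fun m hm => if_pos hm) hxp) ?_,
    ⟨f', k, fun z hz => ?_, fun φ hφ => Or.inr ⟨φ, hφ, rfl⟩⟩, Set.subset_union_left⟩
  · rintro _ ⟨φ, hφ, rfl⟩; exact hmem φ hφ
  · rintro _ ⟨φ, hφ, rfl⟩
    refine lt_of_eq_of_lt (congrArg Subtype.val (x.1.1.eval_congr φ fun z hz => ?_))
      ((hle φ hφ).trans_lt hr'r)
    have hz := F.σ_freeVars k φ hφ z hz
    simp only [Function.comp, hf' z (List.mem_toFinset.2 hz), a']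
    by_cases hzy : z ∈ F.ys k
    · rw [if_pos hzy, if_neg (by omega), Nat.add_sub_cancel_left]
    · have hzx : z ∈ F.xs := (List.mem_append.1 hz).resolve_right hzy
      rw [if_neg hzy, if_pos (hN _ (Finset.mem_image_of_mem _ (List.mem_toFinset.2 hzx))), hs z hzy]
      rfl
  · rw [hf' z (List.mem_toFinset.2 (List.mem_append_left _ hz)), if_neg (hdisj z hz)]

theorem exists_generic_ultrafilter (hL : L.IsCountable) (hA : IsFragment L A) (hAc : A.Countable)
    (hS : IsSubclass L A S) (h𝓜 : 𝓜.Nonempty) (F : ℕ → SupAndInf L A S) (r : ℕ → ℝ)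
    (hsat : ∀ n, SatWithPieces 𝓜 (F n) (r n)) :
    ∃ U : Ultrafilter (Interp 𝓜), IsHenkin S U ∧
      ∀ n (f : ℕ →₀ ℕ), ∃ (f' : ℕ →₀ ℕ) (k : ℕ), (∀ x ∈ (F n).xs, asg f' x = asg f x) ∧
        ∀ φ ∈ (F n).σ k, ∀ᶠ x in (U : Filter (Interp 𝓜)),
          (x.1.1.eval φ (x.2 ∘ asg f') : ℝ) < r n := by
  have := hL.1
  have : Countable S := (hAc.mono hS.subset).to_subtype
  obtain ⟨p₀⟩ := nonempty_cond S h𝓜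
  -- All three index sets are countable: the formulas of `S`, the codes, the rationals and the terms
  -- are.
  let D : (S × (ℕ →₀ ℕ) × ℚ) ⊕ (L.toLanguage.Term ℕ × {q : ℚ // 0 < q}) ⊕ (ℕ × (ℕ →₀ ℕ)) →
      Set (Cond S 𝓜) := Sum.elim (fun i => {p | Witnesses i.1.1 i.2.1 i.2.2 p})
    (Sum.elim (fun i => {p | ∃ j, (PreFormula.atom L.d ![i.1, .var j], 0, (i.2.1 : ℝ)) ∈ p.1})
      fun i => {p | ∃ (f' : ℕ →₀ ℕ) (k : ℕ), (∀ x ∈ (F i.1).xs, asg f' x = asg i.2 x) ∧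
        ∀ φ ∈ (F i.1).σ k, (φ, f', r i.1) ∈ p.1})
  obtain ⟨G, hne, hdir, hG⟩ := exists_generic p₀ D (by
    rintro (i | i | i)
    · exact isCofinal_witnesses hA hS i.1.2 _ _
    · exact isCofinal_term hA hS _ i.2.2
    · exact isCofinal_forced hA hS (hsat i.1) _)
  obtain ⟨U, hU⟩ := exists_ultrafilter_of_directed hne hdir
  refine ⟨U, ⟨?_, ?_, ?_⟩, ?_⟩
  · intro t q hq
    obtain ⟨p, ⟨j, hj⟩, hp⟩ := hG (Sum.inr (Sum.inl (t, ⟨q, hq⟩)))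
    refine ⟨j, (hU p hp).mono fun x hx => ?_⟩
    have := hx _ hj
    simp only [asg_zero, Function.comp_id, MetricStructure.eval] at this
    rwa [x.1.1.relMap_d] at this
  · intro I Φ hmem f q hq hev
    obtain ⟨p, hp, hpG⟩ := hG (Sum.inl (⟨_, hmem⟩, f, q))
    obtain hp | hp | ⟨i, hi⟩ := hp
    · obtain ⟨x, hx1, hx2⟩ := (hev.and (hU p hpG)).exists
      exact absurd (hp x hx2) (not_le.2 hx1)
    · exact absurd hp (not_lt.2 hq)
    · exact ⟨i, (hU p hpG).mono fun x hx => hx _ hi⟩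
  · intro y φ hmem f q hev
    obtain ⟨p, hp, hpG⟩ := hG (Sum.inl (⟨_, hmem⟩, f, q))
    obtain hp | ⟨j, hj⟩ := hp
    · obtain ⟨x, hx1, hx2⟩ := (hev.and (hU p hpG)).exists
      exact absurd (hp x hx2) (not_le.2 hx1)
    · exact ⟨j, (hU p hpG).mono fun x hx => hx _ hj⟩
  · intro n f
    obtain ⟨p, ⟨f', k, hf', hk⟩, hpG⟩ := hG (Sum.inr (Sum.inr (n, f)))
    exact ⟨f', k, hf', fun φ hφ => (hU p hpG).mono fun x hx => hx _ (hk φ hφ)⟩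

/-! ### The forced formulas in the limit structure -/

theorem PreFormula.freeVars_sups (xs : List ℕ) (φ : PreFormula L.toLanguage) :
    (PreFormula.sups xs φ).freeVars = {x | x ∈ φ.freeVars ∧ x ∉ xs} := by
  induction xs with
  | nil => simp [PreFormula.sups]
  | cons y xs ih =>
    change (PreFormula.sups xs φ).freeVars \ {y} = _
    rw [ih]
    ext x
    simp only [Set.mem_sdiff, Set.mem_ofPred_eq, Set.mem_singleton_iff, List.mem_cons]
    tauto

theorem PreFormula.isFormula_of_sups {xs : List ℕ} {φ : PreFormula L.toLanguage}
    (h : IsFormula L (PreFormula.sups xs φ)) : IsFormula L φ := by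
  induction xs with
  | nil => exact h
  | cons x xs ih => exact ih h

theorem SupAndInf.eval_psi_le (F : SupAndInf L A S) (M : MetricStructure.{u, v, w} L)
    {s s' : ℕ → M.carrier} (hs : ∀ x ∈ F.xs, s' x = s x) (k : ℕ) {r : ℝ} (hr : 0 ≤ r)
    (h : ∀ φ ∈ F.σ k, (M.eval φ s' : ℝ) ≤ r) : (M.eval F.psi s : ℝ) ≤ r := by
  classical
  have h1 : M.eval F.psi s ≤ M.eval (PreFormula.infs (F.ys k) (PreFormula.finOr (F.σ k))) s :=
    iInf_le (fun i : (Set.univ : Set ℕ) =>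
      M.eval (PreFormula.infs (F.ys i) (PreFormula.finOr (F.σ i))) s) ⟨k, trivial⟩
  -- The mixed assignment takes the witnesses from `s'` and all else from `s`; it agrees with `s'`
  -- on the free variables of the disjunction.
  have h2 := M.eval_infs_le (F.ys k) (PreFormula.finOr (F.σ k)) s
    (fun x => if x ∈ F.ys k then s' x else s x) fun x hx => if_neg hx
  refine (Subtype.coe_le_coe.2 (h1.trans h2)).trans ?_
  rw [M.eval_congr _ (s' := s')]
  · exact (M.eval_finOr_le_iff _ _ hr).2 h
  · intro x hx
    split_ifs with hy
    · rfl
    · exact (hs x ((F.freeVars_finOr k hx).resolve_right hy)).symm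

end ContLogic

theorem mainTheorem2 (L : Signature.{u, v}) (hL : L.IsCountable)
    (A : Set (PreFormula L.toLanguage)) (hA : IsFragment L A) (hAc : A.Countable)
    (S : Set (PreFormula L.toLanguage)) (hS : IsSubclass L A S)
    (𝓜 : Set (MetricStructure.{u, v, w} L)) (h𝓜 : 𝓜.Nonempty)
    (F : ℕ → SupAndInf L A S) (r : ℕ → ℝ)
    (hsat : ∀ p : Set (PreFormula (L.addConst ℕ).toLanguage × ℝ), IsPiece S 𝓜 p →
      ∀ (n : ℕ) (cs : List ℕ), cs.length = (F n).xs.length →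
        Satisfiable 𝓜 (p ∪ {((F n).psi.atConsts (F n).xs cs, r n)})) :
    ∃ M : MetricStructure.{u, v, w} (L.addConst ℕ),
      M.IsCanonical ∧ ∀ n, M.value ((F n).phi.lift ℕ) ≤ r n := by
  have hsat' : ∀ n, SatWithPieces 𝓜 (F n) (r n) := fun n p hp cs hcs => hsat p hp n cs hcs
  have := hL.1
  have : Small.{w} (L.toLanguage.Term ℕ) := Countable.toSmall _
  obtain ⟨U, hU, hforce⟩ := exists_generic_ultrafilter hL hA hAc hS h𝓜 F r hsat'
  obtain ⟨M, c, hc, hlim⟩ := exists_canonical_limit hA hS hU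
  refine ⟨M.expand c, hc, fun n => ?_⟩
  have hform : IsFormula L (F n).psi := PreFormula.isFormula_of_sups (hA.isFormula _ (F n).mem)
  have hpsi : ∀ t : ℕ → ℕ, (M.eval (F n).psi (c ∘ t) : ℝ) ≤ r n := by
    intro t
    -- Only the values of `t` on `(F n).xs` matter, and those are coded by some `f`.
    obtain ⟨f, hf⟩ := exists_asg_eq (F n).xs.toFinset t
    obtain ⟨f', k, hf', hk⟩ := hforce n f
    refine (F n).eval_psi_le M (s' := c ∘ asg f') (fun x hx => ?_) k
      ((hsat' n).nonneg hA hS h𝓜) fun φ hφ => ?_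
    · rw [Function.comp, hf' x hx, hf x (List.mem_toFinset.2 hx), Function.comp]
    · exact le_of_tendsto ((continuous_subtype_val.tendsto _).comp
        (hlim φ ((F n).σ_mem k φ hφ) f')) ((hk φ hφ).mono fun x hx => hx.le)
  -- `phi` has no free variables, so the assignment in `value` may be replaced by `c ∘ id`.
  refine le_of_eq_of_le (congrArg Subtype.val ?_) (M.eval_sups_le c hc (F n).xs hform hpsi id)
  refine (M.eval_expand_lift c (F n).phi _).trans (M.eval_congr _ fun x hx => ?_)
  rw [SupAndInf.phi, PreFormula.freeVars_sups] at hx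
  exact absurd ((F n).freeVars_psi hx.1) hx.2
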